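/- **Setting.** A *discard category* is a symmetric monoidal category $(\mathcal C,\otimes,I)$ with a map $\mathrm{d}_A:A\to I$ for every object $A$, such that $\mathrm{d}_I=\mathrm{id}_I$ and $\mathrm{d}_{A\otimes B}=\mathrm{d}_A\otimes \mathrm{d}_B$; a morphism $f:A\to B$ is *causal* if $\mathrm{d}_B\circ f=\mathrm{d}_A$. For $f:A\to B$, a morphism $p:A\to B\otimes X$ is a *pseudo-purification* of $f$, written $p\in\mathrm{Pure}(f)$, if for every $g:A\to B\otimes Y$ with $(\mathrm{id}_B\otimes \mathrm{d}_Y)\circ g=f$ there is a causal $c:X\to Y$ with $g=(\mathrm{id}_B\otimes c)\circ p$. $\mathcal C$ is *pseudo-purifiable* if every morphism has a pseudo-purification and if, for $f_1:A_1\to B_1\otimes K$, $f_2:K\otimes A_2\to B_2$, $p_1\in\mathrm{Pure}(f_1)$ and $p_2\in\mathrm{Pure}(f_2)$, the composite of $p_1$ and $p_2$ along $K$ (both purifying systems being kept as outputs) is a pseudo-purification of the composite $(\mathrm{id}_{B_1}\otimes f_2)\circ(f_1\otimes\mathrm{id}_{A_2})$. For $f,g:A\to B$ write $f\preceq g$ if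 there are $g_0:A\to B\otimes X$ and $f_0:X\to I$ with $f=(\mathrm{id}_B\otimes f_0)\circ g_0$ and $g=(\mathrm{id}_B\otimes \mathrm{d}_X)\circ g_0$. **Finite approximations.** An object of $\mathrm{FA}(\mathcal C)$ is a sequence $(A_k)_{k\ge1}$ with $A_{k+1}=A_k\otimes A'_k$, where $A'_k$ is eventually constant. A morphism $(A_k)\to(B_k)$ of $\mathrm{FA}(\mathcal C)$ is a sequence $g_k:A_k\to B_k$ which is *monotone*, i.e. $(\mathrm{id}_{B_k}\otimes \mathrm{d}_{B'_k})\circ g_{k+1}\preceq g_k\otimes \mathrm{d}_{A'_k}$ for all $k\geq 1$, and *regular*, i.e. there are $n\ge1$, an object $M$, and morphisms $g^{\mathrm{irreg}}:A_n\to B_n\otimes M$ and $g^{\mathrm{reg}}:M\otimes A'\to B'\otimes M$ (where $A'_k=A'$ and $B'_k=B'$ for $k\ge n$) such that for every $k\ge n$, $g_k$ is $g^{\mathrm{irreg}}$ followed by $k-n$ copies of $g^{\mathrm{reg}}$ connected along $M$, with the last $M$ discarded. **Diagrams.** Let $\mathcal G$ be a discard category that is a prop (symmetric strict monoidal, with object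 monoid $\mathbb N$). The colored prop $\mathcal G^\omega$ has colors $1$, $\omega$ and $\mathrm D c$ ($c$ a color). Its diagrams are built by composition and tensor from identities, swaps, generators $\mathrm D^n\iota g: p\,\mathrm D^n1\to q\,\mathrm D^n1$ and $\mathrm D^n\omega g:p\,\mathrm D^n\omega\to q\,\mathrm D^n\omega$ for all $g\in\mathcal G(p,q)$, derivatives $\mathrm D^n\omega\to\mathrm D^n1+\mathrm D^{n+1}\omega$ and initializations in the opposite direction, and delayed traces, which turn $a+\mathrm Dc\to b+c$ into $a\to b$. Its morphisms are diagrams modulo the equations of a colored prop, functoriality of $\iota$ and $\omega$, mutual inverseness of derivative and initialization, compatibility of initialization with $\omega g$, the trace axioms (naturality in $a$ and $b$, strength, vanishing), sliding through the trace of swaps, derivatives, initializations and causal maps of $\mathcal G$, copying of idempotents of $\mathcal G$ through the trace, and coinduction (if for every $n$ the equation $S_n=T_n$ is derivable from $\mathrm DS_{n+1}=\mathrm DT_{n+1}$, then $S_0=T_0$). **Semantics.** Let $⟦-⟧:\mathcal G\to\mathcal C$ be a discard-preserving monoidal functor. A wire of color $\mathrm D^n1$ sends one unit of data at tick $n+1$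 only, and one of color $\mathrm D^n\omega$ at each tick from $n+1$ on. A type $a$, sending $a_i$ units at tick $i$, has semantics $⟦a⟧^\omega_k=⟦a_1⟧\otimes\cdots\otimes⟦a_k⟧$. A diagram $D:a\to b$ unfolds to its stateful morphism sequence: memories $m_0=0,m_1,m_2,\dots$ and layers $a_i\otimes m_{i-1}\to b_i\otimes m_i$ in $\mathcal G$ ($\mathrm D^n\iota g$ acts as $g$ at tick $n+1$ only, $\mathrm D^n\omega g$ acts as $g$ at every tick from $n+1$ on, derivatives and initializations act as identities, and the delayed trace stores the output $c$ of a tick in the memory for use as input at the next tick). Apply $⟦-⟧$ to every layer; $⟦D⟧^\omega_k$ is the composite of the first $k$ layers along their memories, with the last memory discarded. This defines the stream semantics $⟦-⟧^\omega:\mathcal G^\omega\to \mathrm{FA}(\mathcal C)$. **Theorem (Universality).** Suppose that $\mathcal C$ is pseudo-purifiable, that $⟦-⟧:\mathcal G\to\mathcal C$ is full, and that every object of $\mathcal C$ is isomorphic, by a causal isomorphism, to $⟦n⟧$ for some $n\in\mathbb N$. Then $⟦-⟧^\omega:\mathcal G^\omega\to\mathrm{FA}(\mathcal C)$ is full: for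 all types $a,b$, every morphism $⟦a⟧^\omega\to⟦b⟧^\omega$ of $\mathrm{FA}(\mathcal C)$, i.e. every monotone regular sequence, is the semantics of some $D\in\mathcal G^\omega(a,b)$. -/

import Mathlib

open CategoryTheory MonoidalCategory

universe v u v₁ u₁ v₂ u₂

namespace StreamLang

/-! # Discard categories and monochromatic props -/

/-- The data and laws of discard maps on a monoidal category: `discard I = id` and
`discard (X ⊗ Y) = discard X ⊗ discard Y`. -/
class DiscardCategory (C : Type u) [Category.{v} C] [MonoidalCategory C] where
  discard : ∀ X : C, X ⟶ 𝟙_ C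
  discard_unit : discard (𝟙_ C) = 𝟙 (𝟙_ C)
  discard_tensor : ∀ X Y : C, discard (X ⊗ Y) = (discard X ⊗ₘ discard Y) ≫ (λ_ (𝟙_ C)).hom

/-- A strict monoidal category: associators and unitors are identities (along equalities of
objects). -/
class StrictMonoidal (C : Type u) [Category.{v} C] [MonoidalCategory C] : Prop where
  tensor_assoc : ∀ X Y Z : C, (X ⊗ Y) ⊗ Z = X ⊗ (Y ⊗ Z)
  unit_tensor : ∀ X : C, 𝟙_ C ⊗ X = X
  tensor_unit : ∀ X : C, X ⊗ 𝟙_ C = X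
  associator_hom : ∀ X Y Z : C, (α_ X Y Z).hom = eqToHom (tensor_assoc X Y Z)
  leftUnitor_hom : ∀ X : C, (λ_ X).hom = eqToHom (unit_tensor X)
  rightUnitor_hom : ∀ X : C, (ρ_ X).hom = eqToHom (tensor_unit X)

/-- The `n`-fold tensor power of an object. -/
def tensorPow {C : Type u} [Category.{v} C] [MonoidalCategory C] (X : C) : ℕ → C
  | 0 => 𝟙_ C
  | n + 1 => X ⊗ tensorPow X n

/-- A (monochromatic) prop: a symmetric strict monoidal category whose monoid of objects is freely
spanned by one object, the `wire`. -/
class MonoProp (G : Type u) [Category.{v} G] [MonoidalCategory G] [SymmetricCategory G]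
    extends StrictMonoidal G where
  wire : G
  free : Function.Bijective (tensorPow wire)

section Props

variable (G : Type u) [Category.{v} G] [MonoidalCategory G] [SymmetricCategory G] [MonoProp G]

/-- The object `n` of a prop. -/
def wires (n : ℕ) : G := tensorPow (MonoProp.wire : G) n

theorem wires_add (m n : ℕ) : wires G (m + n) = wires G m ⊗ wires G n := by
  induction m with
  | zero => rw [Nat.zero_add]; exact (StrictMonoidal.unit_tensor _).symm
  | succ m ih =>
    rw [Nat.succ_add]
    change (MonoProp.wire : G) ⊗ wires G (m + n) = ((MonoProp.wire : G) ⊗ wires G m) ⊗ wires G n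
    rw [ih, StrictMonoidal.tensor_assoc]

/-- The identity `m → n` when `m = n`. -/
def wiresEq {m n : ℕ} (h : m = n) : wires G m ≅ wires G n := eqToIso (congrArg (wires G) h)

/-- The identity `m + n → m ⊗ n`. -/
def wiresSplit (m n : ℕ) : wires G (m + n) ≅ wires G m ⊗ wires G n := eqToIso (wires_add G m n)

variable {G}

/-- The tensor product of two morphisms of a prop, between natural numbers. -/
def wiresTensor {m n p q : ℕ} (g : wires G m ⟶ wires G n) (h : wires G p ⟶ wires G q) :
    wires G (m + p) ⟶ wires G (n + q) :=
  (wiresSplit G m p).hom ≫ (g ⊗ₘ h) ≫ (wiresSplit G n q).inv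

variable (G) in
/-- The symmetry `m + n → n + m` of a prop. -/
def wiresSwap (m n : ℕ) : wires G (m + n) ⟶ wires G (n + m) :=
  (wiresSplit G m n).hom ≫ (β_ (wires G m) (wires G n)).hom ≫ (wiresSplit G n m).inv

end Props

section Discard

variable {C : Type u} [Category.{v} C] [MonoidalCategory C] [DiscardCategory C]

/-- A morphism is causal if discarding its output amounts to discarding its input. -/
def Causal {X Y : C} (f : X ⟶ Y) : Prop :=
  f ≫ DiscardCategory.discard Y = DiscardCategory.discard X

/-- Plug an effect `e : X → I` into the second output of `g : A → B ⊗ X`. -/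
def plug {A B X : C} (g : A ⟶ B ⊗ X) (e : X ⟶ 𝟙_ C) : A ⟶ B :=
  g ≫ B ◁ e ≫ (ρ_ B).hom

/-- Discard the second output of `g : A → B ⊗ X`. -/
def discardOut {A B X : C} (g : A ⟶ B ⊗ X) : A ⟶ B :=
  plug g (DiscardCategory.discard X)

/-- Add a second input to `f : A → B`, which is discarded. -/
def discardIn {A B : C} (f : A ⟶ B) (X : C) : A ⊗ X ⟶ B :=
  A ◁ DiscardCategory.discard X ≫ (ρ_ A).hom ≫ f

/-- `f ≼ g`: there are `g₀ : A → B ⊗ X` and an effect `f₀ : X → I` such that `f` is `g₀` followed by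
`f₀`, and `g` is `g₀` followed by the discard map. -/
def Refines {A B : C} (f g : A ⟶ B) : Prop :=
  ∃ (X : C) (g₀ : A ⟶ B ⊗ X) (f₀ : X ⟶ 𝟙_ C), f = plug g₀ f₀ ∧ g = discardOut g₀

/-- `p` is a pseudo-purification of `f`: whenever `g : A → B ⊗ Y` gives `f` after discarding `Y`,
`g` is `p` followed by a causal map `X → Y`. -/
def IsPseudoPurification {A B X : C} (f : A ⟶ B) (p : A ⟶ B ⊗ X) : Prop :=
  ∀ (Y : C) (g : A ⟶ B ⊗ Y), f = discardOut g → ∃ c : X ⟶ Y, Causal c ∧ g = p ≫ B ◁ c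

/-- Compose `f₁ : A₁ → B₁ ⊗ K` and `f₂ : K ⊗ A₂ → B₂` along the wire `K`. -/
def compAlong {A₁ B₁ K A₂ B₂ : C} (f₁ : A₁ ⟶ B₁ ⊗ K) (f₂ : K ⊗ A₂ ⟶ B₂) : A₁ ⊗ A₂ ⟶ B₁ ⊗ B₂ :=
  f₁ ▷ A₂ ≫ (α_ B₁ K A₂).hom ≫ B₁ ◁ f₂

/-- Compose `p₁ : A₁ → (B₁ ⊗ K) ⊗ X₁` and `p₂ : K ⊗ A₂ → B₂ ⊗ X₂` along the wire `K`, keeping both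
`X₁` and `X₂` as outputs. -/
def compAlongPure [SymmetricCategory C] {A₁ B₁ K A₂ B₂ X₁ X₂ : C}
    (p₁ : A₁ ⟶ (B₁ ⊗ K) ⊗ X₁) (p₂ : K ⊗ A₂ ⟶ B₂ ⊗ X₂) :
    A₁ ⊗ A₂ ⟶ (B₁ ⊗ B₂) ⊗ (X₂ ⊗ X₁) :=
  p₁ ▷ A₂ ≫ (α_ (B₁ ⊗ K) X₁ A₂).hom ≫ (B₁ ⊗ K) ◁ (β_ X₁ A₂).hom ≫
    (α_ (B₁ ⊗ K) A₂ X₁).inv ≫ (α_ B₁ K A₂).hom ▷ X₁ ≫ (B₁ ◁ p₂) ▷ X₁ ≫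
    (α_ B₁ B₂ X₂).inv ▷ X₁ ≫ (α_ (B₁ ⊗ B₂) X₂ X₁).hom

variable (C) in
/-- Every morphism has a pseudo-purification, and pseudo-purifications compose. -/
structure PseudoPurifiable [SymmetricCategory C] : Prop where
  exists_pure : ∀ {A B : C} (f : A ⟶ B), ∃ (X : C) (p : A ⟶ B ⊗ X), IsPseudoPurification f p
  comp_pure : ∀ {A₁ B₁ K A₂ B₂ X₁ X₂ : C} (f₁ : A₁ ⟶ B₁ ⊗ K) (f₂ : K ⊗ A₂ ⟶ B₂)
    (p₁ : A₁ ⟶ (B₁ ⊗ K) ⊗ X₁) (p₂ : K ⊗ A₂ ⟶ B₂ ⊗ X₂),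
    IsPseudoPurification f₁ p₁ → IsPseudoPurification f₂ p₂ →
      IsPseudoPurification (compAlong f₁ f₂) (compAlongPure p₁ p₂)

end Discard

/-! # Finite approximation sequences

Ticks are numbered from `0`: index `k` is the `(k+1)`-st tick of the clock. -/

section FA

variable {C : Type u} [Category.{v} C] [MonoidalCategory C]

/-- `upTo A k = A 0 ⊗ ⋯ ⊗ A k`. -/
def upTo (A : ℕ → C) : ℕ → C
  | 0 => A 0
  | k + 1 => upTo A k ⊗ A (k + 1)

variable (C) in
/-- A monotone and regular sequence of objects `(Aₖ)`. Monotonicity `Aₖ₊₁ = Aₖ ⊗ A'ₖ` is recorded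
by the factors: `A₀ = factor 0` and `A'ₖ = factor (k + 1)`. Regularity says that the factors
are eventually constant. -/
structure FAObj where
  factor : ℕ → C
  regular : ∃ (n : ℕ) (A' : C), ∀ k, n < k → factor k = A'

/-- The `k`-th object of the sequence. -/
def FAObj.obj (A : FAObj C) (k : ℕ) : C := upTo A.factor k

/-- From `g : Aₙ → Bₙ ⊗ M` and layers `M ⊗ A'ₖ → B'ₖ ⊗ M`, the composite `Aₙ₊ⱼ → Bₙ₊ⱼ ⊗ M` of `g` and
of `j` layers, connected along `M`. -/
def iterateFrom {A B : ℕ → C} {M : C} (n : ℕ) (g : upTo A n ⟶ upTo B n ⊗ M)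
    (l : ∀ j, M ⊗ A (n + j + 1) ⟶ B (n + j + 1) ⊗ M) :
    ∀ j, upTo A (n + j) ⟶ upTo B (n + j) ⊗ M
  | 0 => g
  | j + 1 => compAlong (iterateFrom n g l j) (l j) ≫
      (α_ (upTo B (n + j)) (B (n + j + 1)) M).inv

variable [DiscardCategory C]

/-- A sequence of morphisms is monotone if discarding the last output of the `(k+1)`-st
refines the `k`-th with one more, discarded, input. -/
def IsMonotone {A B : FAObj C} (g : ∀ k, A.obj k ⟶ B.obj k) : Prop :=
  ∀ k, Refines (discardOut (B := B.obj k) (X := B.factor (k + 1)) (g (k + 1)))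
    (discardIn (g k) (A.factor (k + 1)))

/-- A sequence of morphisms is regular if, from some index `n` on, it is obtained from
some `girreg : Aₙ → Bₙ ⊗ M` by iterating one fixed `greg : M ⊗ A' → B' ⊗ M` and discarding `M`
at the end. -/
def IsRegular {A B : FAObj C} (g : ∀ k, A.obj k ⟶ B.obj k) : Prop :=
  ∃ (n : ℕ) (M A' B' : C) (hA : ∀ k, n < k → A.factor k = A') (hB : ∀ k, n < k → B.factor k = B')
    (girreg : A.obj n ⟶ B.obj n ⊗ M) (greg : M ⊗ A' ⟶ B' ⊗ M),
    ∀ j, g (n + j) = discardOut (iterateFrom n girreg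
      (fun i => M ◁ eqToHom (hA (n + i + 1) (by omega)) ≫ greg ≫
        eqToHom (hB (n + i + 1) (by omega)).symm ▷ M) j)

/-- The morphisms of the category `FA(C)` of finite approximation sequences: monotone and regular
sequences of morphisms. -/
structure FAHom (A B : FAObj C) where
  app : ∀ k, A.obj k ⟶ B.obj k
  monotone : IsMonotone app
  regular : IsRegular app

end FA

/-! # Stateful morphism sequences -/

section Stateful

variable {C : Type u} [Category.{v} C] [MonoidalCategory C]

/-- A stateful morphism sequence: memories `m k`, where `m 0` is (identified with) the unit, and
layers `A k ⊗ m k → B k ⊗ m (k + 1)`. -/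
structure StSeq (A B : ℕ → C) where
  mem : ℕ → C
  start : 𝟙_ C ≅ mem 0
  layer : ∀ k, A k ⊗ mem k ⟶ B k ⊗ mem (k + 1)

namespace StSeq

/-- The sequence with trivial memory given by morphisms `A k → B k`. -/
def ofHom {A B : ℕ → C} (f : ∀ k, A k ⟶ B k) : StSeq A B where
  mem _ := 𝟙_ C
  start := Iso.refl _
  layer k := f k ▷ 𝟙_ C

/-- Rename the input and output objects along isomorphisms. -/
def retype {A B A' B' : ℕ → C} (i : ∀ k, A' k ≅ A k) (j : ∀ k, B k ≅ B' k) (f : StSeq A B) :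
    StSeq A' B' where
  mem := f.mem
  start := f.start
  layer k := (i k).hom ▷ f.mem k ≫ f.layer k ≫ (j k).hom ▷ f.mem (k + 1)

variable [SymmetricCategory C]

/-- Sequential composition: the layers are composed, the memories are put side by side. -/
def comp {A B D : ℕ → C} (f : StSeq A B) (g : StSeq B D) : StSeq A D where
  mem k := f.mem k ⊗ g.mem k
  start := (λ_ (𝟙_ C)).symm ≪≫ (f.start ⊗ᵢ g.start)
  layer k :=
    (α_ (A k) (f.mem k) (g.mem k)).inv ≫ f.layer k ▷ g.mem k ≫
    (α_ (B k) (f.mem (k + 1)) (g.mem k)).hom ≫ B k ◁ (β_ (f.mem (k + 1)) (g.mem k)).hom ≫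
    (α_ (B k) (g.mem k) (f.mem (k + 1))).inv ≫ g.layer k ▷ f.mem (k + 1) ≫
    (α_ (D k) (g.mem (k + 1)) (f.mem (k + 1))).hom ≫
    D k ◁ (β_ (g.mem (k + 1)) (f.mem (k + 1))).hom

/-- Parallel composition: the layers and the memories are put side by side. -/
def tensor {A B A' B' : ℕ → C} (f : StSeq A B) (g : StSeq A' B') :
    StSeq (fun k => A k ⊗ A' k) (fun k => B k ⊗ B' k) where
  mem k := f.mem k ⊗ g.mem k
  start := (λ_ (𝟙_ C)).symm ≪≫ (f.start ⊗ᵢ g.start)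
  layer k := tensorμ (A k) (A' k) (f.mem k) (g.mem k) ≫ (f.layer k ⊗ₘ g.layer k) ≫
    tensorμ (B k) (f.mem (k + 1)) (B' k) (g.mem (k + 1))

/-- The delayed trace: the additional output `K k` at tick `k` is stored in the
memory and becomes the additional input `K' (k + 1)` at tick `k + 1`. -/
def trace {A B K K' : ℕ → C} (h₀ : 𝟙_ C ≅ K' 0) (h : ∀ k, K k ≅ K' (k + 1))
    (f : StSeq (fun k => A k ⊗ K' k) (fun k => B k ⊗ K k)) : StSeq A B where
  mem k := K' k ⊗ f.mem k
  start := (λ_ (𝟙_ C)).symm ≪≫ (h₀ ⊗ᵢ f.start)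
  layer k := (α_ (A k) (K' k) (f.mem k)).inv ≫ f.layer k ≫
    (α_ (B k) (K k) (f.mem (k + 1))).hom ≫ B k ◁ (h k).hom ▷ f.mem (k + 1)

/-- The layers up to tick `k`, connected along the memories, with the last memory as an additional
output. -/
def run {A B : ℕ → C} (f : StSeq A B) : ∀ k, upTo A k ⟶ upTo B k ⊗ f.mem (k + 1)
  | 0 => (ρ_ (A 0)).inv ≫ A 0 ◁ f.start.hom ≫ f.layer 0
  | k + 1 => compAlong (run f k) ((β_ (f.mem (k + 1)) (A (k + 1))).hom ≫ f.layer (k + 1)) ≫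
      (α_ (upTo B k) (B (k + 1)) (f.mem (k + 2))).inv

/-- The finite approximation sequence: at each tick, the memory is discarded. -/
def approx [DiscardCategory C] {A B : ℕ → C} (f : StSeq A B) (k : ℕ) : upTo A k ⟶ upTo B k :=
  discardOut (run f k)

end StSeq

open Functor.LaxMonoidal Functor.OplaxMonoidal in
/-- Apply a monoidal functor to every layer. -/
def StSeq.map {C : Type u₁} {D : Type u₂} [Category.{v₁} C] [Category.{v₂} D]
    [MonoidalCategory C] [MonoidalCategory D] (F : C ⥤ D) [F.Monoidal] {A B : ℕ → C}
    (f : StSeq A B) : StSeq (fun k => F.obj (A k)) (fun k => F.obj (B k)) where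
  mem k := F.obj (f.mem k)
  start := Functor.Monoidal.εIso F ≪≫ F.mapIso f.start
  layer k := μ F (A k) (f.mem k) ≫ F.map (f.layer k) ≫ δ F (B k) (f.mem (k + 1))

end Stateful

/-! # The stream language over a prop -/

/-- The colors `1`, `ω` and `D c`. -/
inductive Color : Type
  | one : Color
  | omega : Color
  | delay : Color → Color

/-- The color `Dⁿ c`. -/
def Color.delays : ℕ → Color → Color
  | 0, c => c
  | n + 1, c => Color.delay (Color.delays n c)

/-- The number of units of data sent at tick `k` by a wire of a given color. -/
def Color.width : Color → ℕ → ℕ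
  | .one, 0 => 1
  | .one, _ + 1 => 0
  | .omega, _ => 1
  | .delay _, 0 => 0
  | .delay c, k + 1 => c.width k

/-- The types of the language: tensors (that is, lists) of colors. -/
abbrev Ty : Type := List Color

namespace Ty

/-- The delay of a type. -/
def delay (a : Ty) : Ty := a.map Color.delay

/-- The type `m · Dⁿ 1`. -/
def ones (n m : ℕ) : Ty := List.replicate m (Color.delays n Color.one)

/-- The type `m · Dⁿ ω`. -/
def omegas (n m : ℕ) : Ty := List.replicate m (Color.delays n Color.omega)

/-- The number of units of data sent at tick `k` by wires of a given type. -/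
def width (a : Ty) (k : ℕ) : ℕ := (a.map fun c => c.width k).sum

theorem delay_append (a b : Ty) : delay (a ++ b) = delay a ++ delay b := List.map_append

theorem delay_ones (n m : ℕ) : delay (ones n m) = ones (n + 1) m := List.map_replicate

theorem delay_omegas (n m : ℕ) : delay (omegas n m) = omegas (n + 1) m := List.map_replicate

theorem ones_add (n p q : ℕ) : ones n (p + q) = ones n p ++ ones n q := List.replicate_add ..

theorem omegas_add (n p q : ℕ) : omegas n (p + q) = omegas n p ++ omegas n q :=
  List.replicate_add ..

theorem width_append (a b : Ty) (k : ℕ) : width (a ++ b) k = width a k + width b k := by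
  simp [width]

theorem width_delay_zero (a : Ty) : width (delay a) 0 = 0 := by
  simp [width, delay, Function.comp_def, Color.width]

theorem width_delay_succ (a : Ty) (k : ℕ) : width (delay a) (k + 1) = width a k := by
  simp [width, delay, Function.comp_def, Color.width]

end Ty

theorem Color.width_delays_one (n k : ℕ) :
    (Color.delays n .one).width k = if k = n then 1 else 0 := by
  induction n generalizing k with
  | zero => cases k <;> simp [Color.delays, Color.width]
  | succ n ih => cases k <;> simp [Color.delays, Color.width, ih]

theorem Color.width_delays_omega (n k : ℕ) :
    (Color.delays n .omega).width k = if n ≤ k then 1 else 0 := by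
  induction n generalizing k with
  | zero => cases k <;> simp [Color.delays, Color.width]
  | succ n ih => cases k <;> simp [Color.delays, Color.width, ih]

theorem Ty.width_ones (n m k : ℕ) : width (ones n m) k = if k = n then m else 0 := by
  simp [width, ones, Color.width_delays_one]

theorem Ty.width_omegas (n m k : ℕ) : width (omegas n m) k = if n ≤ k then m else 0 := by
  simp [width, omegas, Color.width_delays_omega]

theorem Color.width_eventually (c : Color) :
    ∃ (n w : ℕ), ∀ k, n < k → c.width k = w := by
  induction c with
  | one => exact ⟨0, 0, fun k hk => by cases k <;> simp_all [Color.width]⟩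
  | omega => exact ⟨0, 1, fun k _ => by cases k <;> simp [Color.width]⟩
  | delay c ih =>
    obtain ⟨n, w, h⟩ := ih
    refine ⟨n + 1, w, fun k hk => ?_⟩
    cases k with
    | zero => omega
    | succ k => exact h k (by omega)

theorem Ty.width_eventually (a : Ty) :
    ∃ (n w : ℕ), ∀ k, n < k → width a k = w := by
  induction a with
  | nil => exact ⟨0, 0, fun k _ => by simp [width]⟩
  | cons c a ih =>
    obtain ⟨n, w, h⟩ := ih
    obtain ⟨n', w', h'⟩ := c.width_eventually
    refine ⟨n + n', w' + w, fun k hk => ?_⟩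
    have h1 := h k (by omega)
    have h2 := h' k (by omega)
    simp only [width, List.map_cons, List.sum_cons] at h1 ⊢
    rw [h1, h2]

theorem Ty.width_derivative (n k : ℕ) :
    width (omegas n 1) k = width (ones n 1 ++ omegas (n + 1) 1) k := by
  rw [width_append, width_omegas, width_omegas, width_ones]
  split_ifs <;> omega

section Language

variable (G : Type u) [Category.{v} G] [MonoidalCategory G] [SymmetricCategory G] [MonoProp G]

/-- The diagrams of the stream language over `G`, before any equation is imposed.
They are built from the generators `Dⁿ ι g` and `Dⁿ ω g` for every `g` of `G`, the delayed stream
derivatives and initializations, identities and swaps, by compositions, tensors and delayed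
traces. -/
inductive Diagram : Ty → Ty → Type v
  | id (a : Ty) : Diagram a a
  | comp {a b c : Ty} : Diagram a b → Diagram b c → Diagram a c
  | tensor {a b c d : Ty} : Diagram a b → Diagram c d → Diagram (a ++ c) (b ++ d)
  | swap (a b : Ty) : Diagram (a ++ b) (b ++ a)
  | iota (n : ℕ) {p q : ℕ} (g : wires G p ⟶ wires G q) : Diagram (Ty.ones n p) (Ty.ones n q)
  | omega (n : ℕ) {p q : ℕ} (g : wires G p ⟶ wires G q) :
      Diagram (Ty.omegas n p) (Ty.omegas n q)
  | deriv (n : ℕ) : Diagram (Ty.omegas n 1) (Ty.ones n 1 ++ Ty.omegas (n + 1) 1)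
  | init (n : ℕ) : Diagram (Ty.ones n 1 ++ Ty.omegas (n + 1) 1) (Ty.omegas n 1)
  | trace {a b : Ty} (c : Ty) : Diagram (a ++ c.delay) (b ++ c) → Diagram a b

variable {G}

namespace Diagram

/-- Transport of a diagram along equalities of types. -/
def cast {a b a' b' : Ty} (ha : a = a') (hb : b = b') (D : Diagram G a b) : Diagram G a' b' :=
  ha ▸ hb ▸ D

/-- The delay functor on diagrams. -/
def delay {a b : Ty} : Diagram G a b → Diagram G a.delay b.delay
  | .id a => .id a.delay
  | .comp D E => .comp D.delay E.delay
  | .tensor D E =>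
      cast (Ty.delay_append _ _).symm (Ty.delay_append _ _).symm (.tensor D.delay E.delay)
  | .swap a b =>
      cast (Ty.delay_append _ _).symm (Ty.delay_append _ _).symm (.swap a.delay b.delay)
  | .iota n g => cast (Ty.delay_ones _ _).symm (Ty.delay_ones _ _).symm (.iota (n + 1) g)
  | .omega n g =>
      cast (Ty.delay_omegas _ _).symm (Ty.delay_omegas _ _).symm (.omega (n + 1) g)
  | .deriv n => .deriv (n + 1)
  | .init n => .init (n + 1)
  | .trace c D => .trace c.delay (cast (Ty.delay_append _ _) (Ty.delay_append _ _) D.delay)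

variable (G) in
/-- `p` initializations in parallel: `p · Dⁿ 1 + p · Dⁿ⁺¹ ω → p · Dⁿ ω`. -/
def inits (n : ℕ) : ∀ p : ℕ, Diagram G (Ty.ones n p ++ Ty.omegas (n + 1) p) (Ty.omegas n p)
  | 0 => id []
  | p + 1 =>
    -- move the first wire of type `Dⁿ⁺¹ ω` next to the first wire of type `Dⁿ 1`
    let shuffle : Diagram G (Ty.ones n 1 ++ ((Ty.ones n p ++ Ty.omegas (n + 1) 1) ++
        Ty.omegas (n + 1) p)) (Ty.ones n 1 ++ ((Ty.omegas (n + 1) 1 ++ Ty.ones n p) ++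
        Ty.omegas (n + 1) p)) :=
      tensor (id _) (tensor (swap (Ty.ones n p) (Ty.omegas (n + 1) 1)) (id _))
    comp
      (cast (a' := Ty.ones n (p + 1) ++ Ty.omegas (n + 1) (p + 1))
        (b' := (Ty.ones n 1 ++ Ty.omegas (n + 1) 1) ++ (Ty.ones n p ++ Ty.omegas (n + 1) p))
        (by simp [Ty.ones, Ty.omegas, List.replicate_succ]) (by simp) shuffle)
      (cast rfl (by simp [Ty.omegas, List.replicate_succ]) (tensor (init n) (inits n p)))

/-- The diagrams which slide through a delayed trace: swaps, derivatives, initializations, and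
the images of the causal morphisms of `G`. -/
inductive Slides [DiscardCategory G] : ∀ {a b : Ty}, Diagram G a b → Prop
  | swap (a b : Ty) : Slides (swap a b)
  | deriv (n : ℕ) : Slides (deriv n)
  | init (n : ℕ) : Slides (init n)
  | causal (n : ℕ) {p q : ℕ} (g : wires G p ⟶ wires G q) : Causal g → Slides (iota n g)

variable (G) in
/-- A set of hypothetical equations between diagrams. -/
def Hyps : Type v := ∀ a b : Ty, Diagram G a b → Diagram G a b → Prop

/-- Add one equation to a set of hypothetical equations. -/
inductive Hyps.Add (Γ : Hyps G) {a b : Ty} (S T : Diagram G a b) :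
    ∀ a' b' : Ty, Diagram G a' b' → Diagram G a' b' → Prop
  | old {a' b' : Ty} {S' T' : Diagram G a' b'} : Γ a' b' S' T' → Hyps.Add Γ S T a' b' S' T'
  | new : Hyps.Add Γ S T a b S T

/-- Derivability of an equation between diagrams of the stream language from hypotheses `Γ`. -/
inductive Derives [DiscardCategory G] :
    Hyps G → ∀ {a b : Ty}, Diagram G a b → Diagram G a b → Prop
  -- congruence
  | hyp {Γ : Hyps G} {a b : Ty} {D E : Diagram G a b} : Γ a b D E → Derives Γ D E
  | refl {Γ : Hyps G} {a b : Ty} (D : Diagram G a b) : Derives Γ D D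
  | symm {Γ : Hyps G} {a b : Ty} {D E : Diagram G a b} : Derives Γ D E → Derives Γ E D
  | trans {Γ : Hyps G} {a b : Ty} {D E F : Diagram G a b} :
      Derives Γ D E → Derives Γ E F → Derives Γ D F
  | comp {Γ : Hyps G} {a b c : Ty} {D D' : Diagram G a b} {E E' : Diagram G b c} :
      Derives Γ D D' → Derives Γ E E' → Derives Γ (comp D E) (comp D' E')
  | tensor {Γ : Hyps G} {a b c d : Ty} {D D' : Diagram G a b} {E E' : Diagram G c d} :
      Derives Γ D D' → Derives Γ E E' → Derives Γ (tensor D E) (tensor D' E')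
  | trace {Γ : Hyps G} {a b : Ty} (c : Ty) {D D' : Diagram G (a ++ c.delay) (b ++ c)} :
      Derives Γ D D' → Derives Γ (trace c D) (trace c D')
  -- symmetric strict monoidal category
  | id_comp {Γ : Hyps G} {a b : Ty} (D : Diagram G a b) : Derives Γ (comp (id a) D) D
  | comp_id {Γ : Hyps G} {a b : Ty} (D : Diagram G a b) : Derives Γ (comp D (id b)) D
  | assoc {Γ : Hyps G} {a b c d : Ty} (D : Diagram G a b) (E : Diagram G b c)
      (F : Diagram G c d) : Derives Γ (comp (comp D E) F) (comp D (comp E F))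
  | tensor_id {Γ : Hyps G} (a b : Ty) : Derives Γ (tensor (id a) (id b)) (id (a ++ b))
  | tensor_comp {Γ : Hyps G} {a b c a' b' c' : Ty} (D : Diagram G a b) (E : Diagram G b c)
      (D' : Diagram G a' b') (E' : Diagram G b' c') :
      Derives Γ (tensor (comp D E) (comp D' E')) (comp (tensor D D') (tensor E E'))
  | tensor_assoc {Γ : Hyps G} {a b c d e f : Ty} (D : Diagram G a b) (E : Diagram G c d)
      (F : Diagram G e f) :
      Derives Γ (cast (List.append_assoc _ _ _) (List.append_assoc _ _ _) (tensor (tensor D E) F))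
        (tensor D (tensor E F))
  | unit_tensor {Γ : Hyps G} {a b : Ty} (D : Diagram G a b) : Derives Γ (tensor (id []) D) D
  | tensor_unit {Γ : Hyps G} {a b : Ty} (D : Diagram G a b) :
      Derives Γ (cast (List.append_nil _) (List.append_nil _) (tensor D (id []))) D
  | swap_natural {Γ : Hyps G} {a b c d : Ty} (D : Diagram G a b) (E : Diagram G c d) :
      Derives Γ (comp (tensor D E) (swap b d)) (comp (swap a c) (tensor E D))
  | swap_swap {Γ : Hyps G} (a b : Ty) : Derives Γ (comp (swap a b) (swap b a)) (id (a ++ b))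
  | hexagon {Γ : Hyps G} (a b c : Ty) :
      Derives Γ
        (comp (cast (List.append_assoc _ _ _) (List.append_assoc _ _ _)
            (tensor (swap a b) (id c)))
          (tensor (id b) (swap a c)))
        (cast rfl (List.append_assoc _ _ _) (swap a (b ++ c)))
  -- functoriality of the inclusions of `G`
  | iota_id {Γ : Hyps G} (n p : ℕ) : Derives Γ (iota n (𝟙 (wires G p))) (id _)
  | iota_comp {Γ : Hyps G} (n : ℕ) {p q r : ℕ} (g : wires G p ⟶ wires G q)
      (h : wires G q ⟶ wires G r) : Derives Γ (iota n (g ≫ h)) (comp (iota n g) (iota n h))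
  | iota_tensor {Γ : Hyps G} (n : ℕ) {p q r s : ℕ} (g : wires G p ⟶ wires G q)
      (h : wires G r ⟶ wires G s) :
      Derives Γ (cast (Ty.ones_add _ _ _) (Ty.ones_add _ _ _) (iota n (wiresTensor g h)))
        (tensor (iota n g) (iota n h))
  | iota_swap {Γ : Hyps G} (n p q : ℕ) :
      Derives Γ (cast (Ty.ones_add _ _ _) (Ty.ones_add _ _ _) (iota n (wiresSwap G p q)))
        (swap (Ty.ones n p) (Ty.ones n q))
  | omega_id {Γ : Hyps G} (n p : ℕ) : Derives Γ (omega n (𝟙 (wires G p))) (id _)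
  | omega_comp {Γ : Hyps G} (n : ℕ) {p q r : ℕ} (g : wires G p ⟶ wires G q)
      (h : wires G q ⟶ wires G r) : Derives Γ (omega n (g ≫ h)) (comp (omega n g) (omega n h))
  | omega_tensor {Γ : Hyps G} (n : ℕ) {p q r s : ℕ} (g : wires G p ⟶ wires G q)
      (h : wires G r ⟶ wires G s) :
      Derives Γ (cast (Ty.omegas_add _ _ _) (Ty.omegas_add _ _ _) (omega n (wiresTensor g h)))
        (tensor (omega n g) (omega n h))
  | omega_swap {Γ : Hyps G} (n p q : ℕ) :
      Derives Γ (cast (Ty.omegas_add _ _ _) (Ty.omegas_add _ _ _) (omega n (wiresSwap G p q)))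
        (swap (Ty.omegas n p) (Ty.omegas n q))
  -- derivatives and initializations
  | deriv_init {Γ : Hyps G} (n : ℕ) : Derives Γ (comp (deriv n) (init n)) (id _)
  | init_deriv {Γ : Hyps G} (n : ℕ) : Derives Γ (comp (init n) (deriv n)) (id _)
  | init_omega {Γ : Hyps G} (n : ℕ) {p q : ℕ} (g : wires G p ⟶ wires G q) :
      Derives Γ (comp (inits G n p) (omega n g))
        (comp (tensor (iota n g) (omega (n + 1) g)) (inits G n q))
  -- delayed trace
  | trace_comp_left {Γ : Hyps G} {a a' b c : Ty} (E : Diagram G a' a)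
      (D : Diagram G (a ++ c.delay) (b ++ c)) :
      Derives Γ (trace c (comp (tensor E (id c.delay)) D)) (comp E (trace c D))
  | trace_comp_right {Γ : Hyps G} {a b b' c : Ty} (E : Diagram G b b')
      (D : Diagram G (a ++ c.delay) (b ++ c)) :
      Derives Γ (trace c (comp D (tensor E (id c)))) (comp (trace c D) E)
  | trace_tensor {Γ : Hyps G} {x y a b c : Ty} (E : Diagram G x y)
      (D : Diagram G (a ++ c.delay) (b ++ c)) :
      Derives Γ (trace c (cast (List.append_assoc _ _ _).symm (List.append_assoc _ _ _).symm
        (tensor E D))) (tensor E (trace c D))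
  | trace_append {Γ : Hyps G} {a b : Ty} (c d : Ty)
      (D : Diagram G (a ++ (c ++ d).delay) (b ++ (c ++ d))) :
      Derives Γ (trace (c ++ d) D)
        (trace c (trace d (cast (by rw [Ty.delay_append, List.append_assoc])
          (List.append_assoc _ _ _).symm D)))
  | trace_nil {Γ : Hyps G} {a b : Ty} (D : Diagram G (a ++ Ty.delay []) (b ++ [])) :
      Derives Γ (trace [] D) (cast (List.append_nil _) (List.append_nil _) D)
  -- maps without side effects slide through the trace
  | trace_slide {Γ : Hyps G} {a b c c' : Ty} (K : Diagram G c' c) (hK : Slides K)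
      (D : Diagram G (a ++ c.delay) (b ++ c')) :
      Derives Γ (trace c (comp D (tensor (id b) K))) (trace c' (comp (tensor (id a) K.delay) D))
  -- a copy of an idempotent can be sent through the trace
  | trace_idem {Γ : Hyps G} {a b : Ty} (n : ℕ) {p : ℕ} (g : wires G p ⟶ wires G p)
      (hg : g ≫ g = g) (D : Diagram G (a ++ (Ty.ones n p).delay) (b ++ Ty.ones n p)) :
      Derives Γ (trace _ (comp D (tensor (id b) (iota n g))))
        (trace _ (comp (tensor (id a) (iota n g).delay) (comp D (tensor (id b) (iota n g)))))
  -- coinduction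
  | coind {Γ : Hyps G} (a b : ℕ → Ty) (S T : ∀ n, Diagram G (a n) (b n)) :
      (∀ n, Derives (Hyps.Add Γ (S (n + 1)).delay (T (n + 1)).delay) (S n) (T n)) →
        Derives Γ (S 0) (T 0)

/-- Two diagrams are equal in the stream language if this can be derived without hypotheses. -/
def Equal [DiscardCategory G] {a b : Ty} (D E : Diagram G a b) : Prop :=
  Derives (fun _ _ _ _ => False) D E

/-- The stateful morphism sequence of a diagram. -/
def toSt : ∀ {a b : Ty}, Diagram G a b →
    StSeq (fun k => wires G (a.width k)) (fun k => wires G (b.width k))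
  | _, _, .id _ => StSeq.ofHom fun _ => 𝟙 _
  | _, _, .comp D E => D.toSt.comp E.toSt
  | _, _, .tensor D E =>
      (D.toSt.tensor E.toSt).retype
        (fun k => wiresEq G (Ty.width_append _ _ k) ≪≫ wiresSplit G _ _)
        (fun k => (wiresEq G (Ty.width_append _ _ k) ≪≫ wiresSplit G _ _).symm)
  | _, _, .swap a b =>
      StSeq.ofHom fun k => (wiresEq G (Ty.width_append a b k)).hom ≫
        wiresSwap G (a.width k) (b.width k) ≫ (wiresEq G (Ty.width_append b a k)).inv
  | _, _, .iota n (p := p) (q := q) g =>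
      StSeq.ofHom fun k =>
        if h : k = n then
          (wiresEq G (by rw [Ty.width_ones, if_pos h])).hom ≫ g ≫
            (wiresEq G (by rw [Ty.width_ones, if_pos h])).hom
        else (wiresEq G (by rw [Ty.width_ones, Ty.width_ones, if_neg h, if_neg h])).hom
  | _, _, .omega n (p := p) (q := q) g =>
      StSeq.ofHom fun k =>
        if h : n ≤ k then
          (wiresEq G (by rw [Ty.width_omegas, if_pos h])).hom ≫ g ≫
            (wiresEq G (by rw [Ty.width_omegas, if_pos h])).hom
        else (wiresEq G (by rw [Ty.width_omegas, Ty.width_omegas, if_neg h, if_neg h])).hom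
  | _, _, .deriv n => StSeq.ofHom fun k => (wiresEq G (Ty.width_derivative n k)).hom
  | _, _, .init n => StSeq.ofHom fun k => (wiresEq G (Ty.width_derivative n k)).inv
  | _, _, .trace c D =>
      StSeq.trace
        (K := fun k => wires G (c.width k)) (K' := fun k => wires G (c.delay.width k))
        (wiresEq G (m := 0) (Ty.width_delay_zero c).symm)
        (fun k => wiresEq G (Ty.width_delay_succ c k).symm)
        (D.toSt.retype
          (fun k => (wiresEq G (Ty.width_append _ _ k) ≪≫ wiresSplit G _ _).symm)
          (fun k => wiresEq G (Ty.width_append _ _ k) ≪≫ wiresSplit G _ _))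

end Diagram

variable (G) in
/-- The morphisms of the stream language over `G`: diagrams up to the derivable equations. -/
def StreamHom [DiscardCategory G] (a b : Ty) : Type v :=
  Quot (Diagram.Equal (G := G) (a := a) (b := b))

end Language

/-! # The stream semantics -/

section Semantics

variable {G : Type u₁} [Category.{v₁} G] [MonoidalCategory G] [SymmetricCategory G] [MonoProp G]
  {C : Type u₂} [Category.{v₂} C] [MonoidalCategory C] [SymmetricCategory C]

/-- The semantics of a type: `⟦a⟧ₖ = F a₀ ⊗ ⋯ ⊗ F aₖ`, where `aᵢ` is the number of units of data sent
at tick `i`. -/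
def semTy (F : G ⥤ C) (a : Ty) : FAObj C where
  factor k := F.obj (wires G (a.width k))
  regular := by
    obtain ⟨n, w, h⟩ := a.width_eventually
    exact ⟨n, F.obj (wires G w), fun k hk => by rw [h k hk]⟩

variable [DiscardCategory C]

/-- The semantics of a diagram: the finite approximations of the stateful morphism sequence
obtained by applying `F` to every layer. -/
def Diagram.sem (F : G ⥤ C) [F.Monoidal] {a b : Ty} (D : Diagram G a b) (k : ℕ) :
    (semTy F a).obj k ⟶ (semTy F b).obj k :=
  (D.toSt.map F).approx k

/-- `g` is the semantics of the morphism `D` of the stream language, that is, of a diagram that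
represents `D`. The equations of the language are sound: which representative is taken does not
matter. -/
def StreamHom.Denotes [DiscardCategory G] (F : G ⥤ C) [F.Monoidal] {a b : Ty}
    (D : StreamHom G a b) (g : ∀ k, (semTy F a).obj k ⟶ (semTy F b).obj k) : Prop :=
  ∃ E : Diagram G a b, Quot.mk _ E = D ∧ E.sem F = g

/-- A monoidal functor between discard categories that preserves the discard maps. -/
def DiscardPreserving [DiscardCategory G] (F : G ⥤ C) [F.Monoidal] : Prop :=
  ∀ X : G, F.map (DiscardCategory.discard X) ≫ Functor.OplaxMonoidal.η F =
    DiscardCategory.discard (F.obj X)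

end Semantics

end StreamLang

open StreamLang

namespace StreamLang

/-! ### Pseudo-purifications and the existence of layers -/

section Purification

variable {C : Type u} [Category.{v} C] [MonoidalCategory C]

/-! A sequence `g` is the semantics of a diagram once it is cut into layers: maps `s k` that give `g
k` after discarding a memory, such that `s (k + 1)` is `s k` followed by a layer acting only on the
memory and the new input. The layers must be eventually constant, because a diagram is finite.

Regularity supplies such states and a constant layer from some tick on, but says nothing earlier.
There, `s k` is chosen to be a pseudo-purification of `g k`. By `IsPseudoPurification.exists_layer`,
monotonicity then makes every dilation of `g (k + 1)` factor through `s k`. The dilation need not be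
pure, so the last purification can be joined to the regular tail. Purifying at every tick instead
would lose control over the layers at infinity.

Memories are replaced by objects in the image of the functor, along causal isomorphisms, and
fullness lifts each layer to the prop. It remains to see that an eventually constant stateful
sequence over the prop comes from a diagram (`exists_toSt_equivalent`). A single delayed trace
carries the whole memory, which reduces the question to memoryless families (`exists_realizes`).
Derivatives and initializations rewire every type into a normal form that lists finitely many ticks
separately and then one block of `ω` wires. Between normal forms, the family is a tensor of
generators `ι` and one `ω`. -/

theorem plug_comp_whiskerLeft {A B X Y : C} (p : A ⟶ B ⊗ X) (c : X ⟶ Y) (e : Y ⟶ 𝟙_ C) :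
    plug (p ≫ B ◁ c) e = plug p (c ≫ e) := by
  simp [plug]

variable [DiscardCategory C]

open DiscardCategory

theorem discardOut_comp_whiskerLeft {A B X Y : C} (p : A ⟶ B ⊗ X) {c : X ⟶ Y} (hc : Causal c) :
    discardOut (p ≫ B ◁ c) = discardOut p := by
  rw [discardOut, plug_comp_whiskerLeft, hc, discardOut]

theorem discardOut_rightUnitor_inv {A B : C} (f : A ⟶ B) :
    discardOut (f ≫ (ρ_ B).inv) = f := by
  simp [discardOut, plug, discard_unit]

theorem discardOut_comp_associator {A B X Y : C} (p : A ⟶ (B ⊗ X) ⊗ Y) :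
    discardOut (p ≫ (α_ B X Y).hom) = discardOut (discardOut p) := by
  simp only [discardOut, plug, discard_tensor, MonoidalCategory.tensorHom_def]
  simp only [MonoidalCategory.whiskerLeft_comp, Category.assoc, ← whisker_exchange_assoc]
  monoidal

/-- The definition does not ask that `p` dilate `f`. This follows by testing it on `f` itself, with
the unit as purifying system: a causal map after `p` is invisible once the system is discarded. -/
theorem IsPseudoPurification.discardOut_eq {A B X : C} {f : A ⟶ B} {p : A ⟶ B ⊗ X}
    (h : IsPseudoPurification f p) : discardOut p = f := by
  obtain ⟨c, hc, e⟩ := h (𝟙_ C) (f ≫ (ρ_ B).inv) (discardOut_rightUnitor_inv f).symm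
  rw [← discardOut_comp_whiskerLeft p hc, ← e, discardOut_rightUnitor_inv]

variable [SymmetricCategory C]

theorem causal_braiding (X Y : C) : Causal (β_ X Y).hom := by
  rw [Causal, discard_tensor, discard_tensor, ← BraidedCategory.braiding_naturality_assoc,
    braiding_tensorUnit_left]
  simp [unitors_equal]

/-- The identity of `A'` purifies the discard map of `A'`: the discarded input is kept. Composing
this with `p` along the unit object gives the claim. -/
theorem isPseudoPurification_discardIn (hC : PseudoPurifiable C) {A B X : C} {f : A ⟶ B}
    {p : A ⟶ B ⊗ X} (h : IsPseudoPurification f p) (A' : C) :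
    IsPseudoPurification (discardIn f A') (p ▷ A' ≫ (α_ B X A').hom) := by
  have h₁ : IsPseudoPurification (f ≫ (ρ_ B).inv) (p ≫ (ρ_ B).inv ▷ X) := by
    intro Y g hg
    obtain ⟨c, hc, e⟩ := h Y (g ≫ (ρ_ B).hom ▷ Y) (by
      rw [← cancel_mono (ρ_ B).inv, hg]
      simp only [discardOut, plug, Category.assoc, ← whisker_exchange_assoc]
      simp)
    refine ⟨c, hc, ?_⟩
    rw [← cancel_mono ((ρ_ B).hom ▷ Y), e, Category.assoc, Category.assoc, whisker_exchange]
    simp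
  have h₂ : IsPseudoPurification ((λ_ A').hom ≫ discard A') (𝟙 (𝟙_ C ⊗ A')) := by
    intro Y g hg
    refine ⟨(λ_ A').inv ≫ g ≫ (λ_ Y).hom, ?_, ?_⟩
    · rw [discardOut, plug, id_whiskerLeft] at hg
      rw [Causal, ← cancel_epi (λ_ A').hom, hg]
      simp [← unitors_equal]
    · simp
  have h₃ := hC.comp_pure _ _ _ _ h₁ h₂
  intro Y g hg
  obtain ⟨c, hc, e⟩ := h₃ Y (g ≫ (ρ_ B).inv ▷ Y) (by
    trans discardIn f A' ≫ (ρ_ B).inv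
    · simp [compAlong, discardIn]
      rw [← whisker_exchange]
      simp
    · rw [hg]
      simp [discardOut, plug])
  -- `compAlongPure` lists the second purifying system first, so the two systems have to be
  -- exchanged.
  refine ⟨(β_ X A').hom ≫ c, ?_, ?_⟩
  · rw [Causal, Category.assoc, hc, causal_braiding]
  rw [← cancel_mono ((ρ_ B).inv ▷ Y), e]
  simp [compAlongPure]

/-- Monotonicity and purity of `p` show that `discardOut f'` is `p` followed by an effect on `X ⊗
A'`. Purify `p` and this effect. The composite purifies `discardOut f'`, so the dilation `p'` of it
factors through the composite. The purification of `p` also dilates `f`, hence factors through `p`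
in turn. Only `p` has to be pure, not `p'`. -/
theorem IsPseudoPurification.exists_layer (hC : PseudoPurifiable C) {A B X A' B' X' : C}
    {f : A ⟶ B} {p : A ⟶ B ⊗ X} (h : IsPseudoPurification f p) {f' : A ⊗ A' ⟶ B ⊗ B'}
    (hf : Refines (discardOut f') (discardIn f A')) {p' : A ⊗ A' ⟶ (B ⊗ B') ⊗ X'}
    (hp : discardOut p' = f') :
    ∃ l : X ⊗ A' ⟶ B' ⊗ X', p' = compAlong p l ≫ (α_ B B' X').inv := by
  obtain ⟨Y, g₀, f₀, h₁, h₂⟩ := hf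
  obtain ⟨c, -, rfl⟩ := isPseudoPurification_discardIn hC h A' _ g₀ h₂
  obtain ⟨Y, P, hP⟩ := hC.exists_pure p
  obtain ⟨Z, q, hq⟩ := hC.exists_pure (c ≫ f₀)
  -- Discarding `Y` and then `X` turns `P` into `p` and then `f`, so `P` is a dilation of `f` by `X
  -- ⊗ Y`.
  obtain ⟨d, -, hd⟩ := h _ (P ≫ (α_ B X Y).hom) (by
    rw [discardOut_comp_associator, hP.discardOut_eq, h.discardOut_eq])
  -- Here the output `B'` counts as part of the dilating system of `p'`. The effect has the unit as
  -- output, whence the unitor.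
  obtain ⟨d', -, hd'⟩ := hC.comp_pure _ _ _ _ hP hq (B' ⊗ X')
    (p' ≫ (α_ B B' X').hom ≫ (ρ_ B).inv ▷ (B' ⊗ X')) (by
      rw [← cancel_mono (ρ_ B).hom]
      trans discardOut (p' ≫ (α_ B B' X').hom)
      · rw [discardOut_comp_associator, hp, h₁]
        simp [plug, compAlong]
      · simp [discardOut, plug])
  refine ⟨d ▷ A' ≫ (α_ X Y A').hom ≫ X ◁ (β_ Y A').hom ≫ (α_ X A' Y).inv ≫ q ▷ Y ≫
    (α_ _ Z Y).hom ≫ (λ_ _).hom ≫ d', ?_⟩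
  have hd2 : P = p ≫ B ◁ d ≫ (α_ B X Y).inv := by simp [← reassoc_of% hd]
  rw [← cancel_mono (α_ B B' X').hom, ← cancel_mono ((ρ_ B).inv ▷ (B' ⊗ X')), Category.assoc, hd',
    hd2]
  simp [compAlong, compAlongPure]
  monoidal

end Purification

open DiscardCategory

/-! ### Closure properties of causal maps -/

section CausalLemmas

variable {C : Type u} [Category.{v} C] [MonoidalCategory C] [DiscardCategory C]

theorem Causal.id (X : C) : Causal (𝟙 X) := Category.id_comp _

theorem Causal.comp {X Y Z : C} {f : X ⟶ Y} {g : Y ⟶ Z} (hf : Causal f) (hg : Causal g) :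
    Causal (f ≫ g) := by
  rw [Causal, Category.assoc, hg, hf]

theorem Causal.inv {X Y : C} {e : X ≅ Y} (h : Causal e.hom) : Causal e.inv := by
  rw [Causal, Iso.inv_comp_eq, h]

theorem Causal.tensorHom {X Y X' Y' : C} {f : X ⟶ Y} {g : X' ⟶ Y'} (hf : Causal f)
    (hg : Causal g) : Causal (f ⊗ₘ g) := by
  rw [Causal, discard_tensor, discard_tensor, tensorHom_comp_tensorHom_assoc, hf, hg]

theorem Causal.leftUnitor (X : C) : Causal (λ_ X).hom := by
  rw [Causal, discard_tensor, discard_unit, id_tensorHom, leftUnitor_naturality]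

theorem Causal.rightUnitor (X : C) : Causal (ρ_ X).hom := by
  rw [Causal, discard_tensor, discard_unit, tensorHom_id, unitors_equal, rightUnitor_naturality]

theorem Causal.eqToHom {X Y : C} (h : X = Y) : Causal (eqToHom h) := by
  subst h; exact Causal.id X

end CausalLemmas

/-! ### Stateful sequences up to causal isomorphism of the memories -/

namespace StSeq

section Equivalence

theorem run_eq_of_iso {C : Type u} [Category.{v} C] [MonoidalCategory C] [SymmetricCategory C]
    {A B : ℕ → C} {f g : StSeq A B} {e : ∀ k, f.mem k ≅ g.mem k}
    (h₂ : f.start.hom ≫ (e 0).hom = g.start.hom)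
    (h₃ : ∀ k, f.layer k ≫ B k ◁ (e (k + 1)).hom = A k ◁ (e k).hom ≫ g.layer k) (k : ℕ) :
    g.run k = f.run k ≫ upTo B k ◁ (e (k + 1)).hom := by
  induction k with
  | zero => simp [StSeq.run, ← h₂, h₃, upTo]
  | succ k ih =>
    simp only [StSeq.run, ih, compAlong, upTo]
    have := congrArg (fun x => upTo B k ◁ x) (h₃ (k + 1))
    simp only [MonoidalCategory.whiskerLeft_comp] at this
    have h4 := congrArg (fun x => upTo B k ◁ x)
      (BraidedCategory.braiding_naturality_left (e (k + 1)).hom (A (k + 1)))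
    simp only [MonoidalCategory.whiskerLeft_comp] at h4
    simp [reassoc_of% this, reassoc_of% h4]

variable {C : Type u} [Category.{v} C] [MonoidalCategory C] [DiscardCategory C]

/-- Two stateful morphism sequences are equivalent if they agree up to causal isomorphisms of their
memories. -/
def Equivalent {A B : ℕ → C} (f g : StSeq A B) : Prop :=
  ∃ e : ∀ k, f.mem k ≅ g.mem k, (∀ k, Causal (e k).hom) ∧ f.start.hom ≫ (e 0).hom = g.start.hom ∧
    ∀ k, f.layer k ≫ B k ◁ (e (k + 1)).hom = A k ◁ (e k).hom ≫ g.layer k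

theorem Equivalent.refl {A B : ℕ → C} (f : StSeq A B) : f.Equivalent f :=
  ⟨fun k => Iso.refl _, fun _ => Causal.id _, by simp, by simp⟩

theorem Equivalent.trans {A B : ℕ → C} {f g h : StSeq A B} (hf : f.Equivalent g)
    (hg : g.Equivalent h) : f.Equivalent h := by
  obtain ⟨e, h₁, h₂, h₃⟩ := hf
  obtain ⟨e', h₁', h₂', h₃'⟩ := hg
  refine ⟨fun k => e k ≪≫ e' k, fun k => (h₁ k).comp (h₁' k), by simp [← h₂', ← h₂], fun k => ?_⟩
  simp [reassoc_of% h₃, h₃']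

theorem Equivalent.retype {A B A' B' : ℕ → C} (i : ∀ k, A' k ≅ A k) (j : ∀ k, B k ≅ B' k)
    {f g : StSeq A B} (h : f.Equivalent g) : (f.retype i j).Equivalent (g.retype i j) := by
  obtain ⟨e, h₁, h₂, h₃⟩ := h
  refine ⟨e, h₁, h₂, fun k => ?_⟩
  simp only [StSeq.retype, Category.assoc]
  rw [← whisker_exchange, reassoc_of% h₃ k, whisker_exchange_assoc]

/-- This is where preservation of discards matters: it makes the images of the memory isomorphisms
causal. -/
theorem Equivalent.map {D : Type u₂} [Category.{v₂} D] [MonoidalCategory D] [DiscardCategory D]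
    {F : C ⥤ D} [F.Monoidal]
    (hF : ∀ X : C, F.map (discard X) ≫ Functor.OplaxMonoidal.η F = discard (F.obj X))
    {A B : ℕ → C} {f g : StSeq A B} (h : f.Equivalent g) : (f.map F).Equivalent (g.map F) := by
  obtain ⟨e, h₁, h₂, h₃⟩ := h
  refine ⟨fun k => F.mapIso (e k), fun k => ?_, ?_, fun k => ?_⟩
  · change F.map _ ≫ discard (F.obj _) = discard (F.obj _)
    rw [← hF, ← hF, ← h₁ k, F.map_comp_assoc]
  · simp [StSeq.map, ← h₂]
  · simp only [StSeq.map, Category.assoc, Functor.mapIso_hom]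
    rw [Functor.OplaxMonoidal.δ_natural_right, ← F.map_comp_assoc, h₃, F.map_comp_assoc,
      ← Functor.LaxMonoidal.μ_natural_right_assoc]

variable [SymmetricCategory C]

/-- The two runs differ by an isomorphism of the last memory. Being causal, it is absorbed when that
memory is discarded. -/
theorem Equivalent.approx_eq {A B : ℕ → C} {f g : StSeq A B} (h : f.Equivalent g) (k : ℕ) :
    f.approx k = g.approx k := by
  obtain ⟨e, h₁, h₂, h₃⟩ := h
  rw [StSeq.approx, StSeq.approx, run_eq_of_iso h₂ h₃, discardOut_comp_whiskerLeft _ (h₁ _)]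

end Equivalence

/-! ### Sequences with trivial memory -/

section OfHom

variable {C : Type u} [Category.{v} C] [MonoidalCategory C]

theorem retype_ofHom {A B A' B' : ℕ → C} (i : ∀ k, A' k ≅ A k) (j : ∀ k, B k ≅ B' k)
    (f : ∀ k, A k ⟶ B k) :
    (ofHom f).retype i j = ofHom fun k => (i k).hom ≫ f k ≫ (j k).hom := by
  simp [ofHom, StSeq.retype]

theorem unit_start {M N : C} {s : 𝟙_ C ⟶ M} {e : M ⟶ 𝟙_ C} {s' : 𝟙_ C ⟶ N} {e' : N ⟶ 𝟙_ C}
    (h : s ≫ e = 𝟙 _) (h' : s' ≫ e' = 𝟙 _) :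
    ((λ_ (𝟙_ C)).inv ≫ (s ⊗ₘ s')) ≫ (e ⊗ₘ e') ≫ (λ_ (𝟙_ C)).hom = 𝟙 (𝟙_ C) := by
  rw [Category.assoc, tensorHom_comp_tensorHom_assoc, h, h']
  simp

theorem equivalent_ofHom_iff [DiscardCategory C] {A B : ℕ → C} {f : StSeq A B}
    {t : ∀ k, A k ⟶ B k} : f.Equivalent (ofHom t) ↔ ∃ e : ∀ k, f.mem k ≅ 𝟙_ C,
      (∀ k, Causal (e k).hom) ∧ f.start.hom ≫ (e 0).hom = 𝟙 _ ∧
      ∀ k, f.layer k ≫ B k ◁ (e (k + 1)).hom = A k ◁ (e k).hom ≫ t k ▷ 𝟙_ C :=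
  Iff.rfl

section Layer

variable [SymmetricCategory C]

theorem braiding_unit_unit : (β_ (𝟙_ C) (𝟙_ C)).hom = 𝟙 _ := by
  rw [braiding_tensorUnit_left, unitors_equal, Iso.hom_inv_id]

/-- One tick of `Equivalent.comp_ofHom`. The composite of two memoryless sequences carries the
memory `I ⊗ I`, which is only isomorphic to `I`. The hypotheses are solved for `l` and `l'`, and the
rest is coherence. -/
theorem comp_layer {A B D M M₁ N N₁ : C} {e : M ≅ 𝟙_ C} {e₁ : M₁ ≅ 𝟙_ C} {d : N ≅ 𝟙_ C}
    {d₁ : N₁ ≅ 𝟙_ C} {f : A ⟶ B} {g : B ⟶ D} {l : A ⊗ M ⟶ B ⊗ M₁} {l' : B ⊗ N ⟶ D ⊗ N₁}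
    (h : l ≫ B ◁ e₁.hom = A ◁ e.hom ≫ f ▷ 𝟙_ C) (h' : l' ≫ D ◁ d₁.hom = B ◁ d.hom ≫ g ▷ 𝟙_ C) :
    ((α_ A M N).inv ≫ l ▷ N ≫ (α_ B M₁ N).hom ≫ B ◁ (β_ M₁ N).hom ≫ (α_ B N M₁).inv ≫ l' ▷ M₁ ≫
      (α_ D N₁ M₁).hom ≫ D ◁ (β_ N₁ M₁).hom) ≫ D ◁ ((e₁.hom ⊗ₘ d₁.hom) ≫ (λ_ (𝟙_ C)).hom) =
    A ◁ ((e.hom ⊗ₘ d.hom) ≫ (λ_ (𝟙_ C)).hom) ≫ (f ≫ g) ▷ 𝟙_ C := by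
  obtain rfl : l = A ◁ e.hom ≫ f ▷ 𝟙_ C ≫ B ◁ e₁.inv := by
    rw [← reassoc_of% h]; simp
  obtain rfl : l' = B ◁ d.hom ≫ g ▷ 𝟙_ C ≫ D ◁ d₁.inv := by
    rw [← reassoc_of% h']; simp
  have h1 : e₁.inv ▷ N ≫ (β_ M₁ N).hom = (β_ (𝟙_ C) N).hom ≫ N ◁ e₁.inv := by simp
  have h2 : (β_ N₁ M₁).hom ≫ (e₁.hom ⊗ₘ d₁.hom) = (d₁.hom ⊗ₘ e₁.hom) := by
    rw [← BraidedCategory.braiding_naturality, braiding_unit_unit, Category.comp_id]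
  simp only [comp_whiskerRight, Category.assoc, associator_naturality_middle_assoc,
    ← MonoidalCategory.whiskerLeft_comp, ← MonoidalCategory.whiskerLeft_comp_assoc, h1,
    reassoc_of% h2]
  simp [MonoidalCategory.tensorHom_def]
  rw [← whiskerLeft_rightUnitor_inv_assoc]
  have h3 : (ρ_ N).inv ≫ N ◁ e₁.inv ≫ d.hom ▷ M₁ ≫ (λ_ M₁).hom ≫ e₁.hom = d.hom := by
    rw [whisker_exchange_assoc]; simp [unitors_equal]
  simp only [← whisker_exchange_assoc, ← whisker_exchange]
  simp only [← MonoidalCategory.whiskerLeft_comp_assoc, h3]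
  simp

theorem tensor_layer {A B A' B' M M₁ N N₁ : C} {e : M ≅ 𝟙_ C} {e₁ : M₁ ≅ 𝟙_ C} {d : N ≅ 𝟙_ C}
    {d₁ : N₁ ≅ 𝟙_ C} {f : A ⟶ B} {g : A' ⟶ B'} {l : A ⊗ M ⟶ B ⊗ M₁} {l' : A' ⊗ N ⟶ B' ⊗ N₁}
    (h : l ≫ B ◁ e₁.hom = A ◁ e.hom ≫ f ▷ 𝟙_ C)
    (h' : l' ≫ B' ◁ d₁.hom = A' ◁ d.hom ≫ g ▷ 𝟙_ C) :
    (tensorμ A A' M N ≫ (l ⊗ₘ l') ≫ tensorμ B M₁ B' N₁) ≫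
      (B ⊗ B') ◁ ((e₁.hom ⊗ₘ d₁.hom) ≫ (λ_ (𝟙_ C)).hom) =
    (A ⊗ A') ◁ ((e.hom ⊗ₘ d.hom) ≫ (λ_ (𝟙_ C)).hom) ≫ (f ⊗ₘ g) ▷ 𝟙_ C := by
  have h1 : tensorμ B M₁ B' N₁ ≫ (B ⊗ B') ◁ (e₁.hom ⊗ₘ d₁.hom) =
      ((B ◁ e₁.hom) ⊗ₘ (B' ◁ d₁.hom)) ≫ tensorμ B (𝟙_ C) B' (𝟙_ C) := by
    have := tensorμ_natural (𝟙 B) e₁.hom (𝟙 B') d₁.hom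
    simpa using this.symm
  have h2 : tensorμ A A' M N ≫ ((A ◁ e.hom) ⊗ₘ (A' ◁ d.hom)) =
      (A ⊗ A') ◁ (e.hom ⊗ₘ d.hom) ≫ tensorμ A A' (𝟙_ C) (𝟙_ C) := by
    have := tensorμ_natural (𝟙 A) (𝟙 A') e.hom d.hom
    simpa using this.symm
  have h3 : tensorμ A A' (𝟙_ C) (𝟙_ C) ≫ (f ▷ 𝟙_ C ⊗ₘ g ▷ 𝟙_ C) =
      ((f ⊗ₘ g) ▷ (𝟙_ C ⊗ 𝟙_ C)) ≫ tensorμ B B' (𝟙_ C) (𝟙_ C) := by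
    have := tensorμ_natural f g (𝟙 (𝟙_ C)) (𝟙 (𝟙_ C))
    simpa using this.symm
  have h4 : tensorμ B B' (𝟙_ C) (𝟙_ C) ≫ tensorμ B (𝟙_ C) B' (𝟙_ C) = 𝟙 _ := by
    simp [tensorμ]
  rw [MonoidalCategory.whiskerLeft_comp, Category.assoc, Category.assoc,
    reassoc_of% h1, tensorHom_comp_tensorHom_assoc, h, h',
    ← tensorHom_comp_tensorHom_assoc, reassoc_of% h2, reassoc_of% h3, reassoc_of% h4]
  simp only [MonoidalCategory.whiskerLeft_comp, Category.assoc, whisker_exchange]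

end Layer

variable [DiscardCategory C]

/-- The delayed trace of a sequence without memory has the traced wires as its only memory. -/
theorem Equivalent.trace_ofHom {A B K K' : ℕ → C} (h₀ : 𝟙_ C ≅ K' 0)
    (h : ∀ k, K k ≅ K' (k + 1)) {f : StSeq (fun k => A k ⊗ K' k) (fun k => B k ⊗ K k)}
    {t : ∀ k, A k ⊗ K' k ⟶ B k ⊗ K k} (hf : f.Equivalent (ofHom t)) :
    (f.trace h₀ h).Equivalent
      { mem := K', start := h₀, layer := fun k => t k ≫ B k ◁ (h k).hom } := by
  obtain ⟨e, h₁, h₂, h₃⟩ := equivalent_ofHom_iff.1 hf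
  refine ⟨fun k => (K' k ◁ᵢ e k) ≪≫ ρ_ (K' k), fun k => ?_, ?_, fun k => ?_⟩
  · refine Causal.comp ?_ (Causal.rightUnitor _)
    rw [whiskerLeftIso_hom, ← id_tensorHom]
    exact (Causal.id _).tensorHom (h₁ k)
  · change ((λ_ (𝟙_ C)).inv ≫ (h₀.hom ⊗ₘ f.start.hom)) ≫ K' 0 ◁ (e 0).hom ≫ (ρ_ _).hom = h₀.hom
    rw [← id_tensorHom, Category.assoc, tensorHom_comp_tensorHom_assoc, h₂]
    simp [unitors_inv_equal]
  · change ((α_ (A k) (K' k) (f.mem k)).inv ≫ f.layer k ≫ (α_ (B k) (K k) (f.mem (k + 1))).hom ≫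
      B k ◁ (h k).hom ▷ f.mem (k + 1)) ≫ B k ◁ (K' (k + 1) ◁ (e (k + 1)).hom ≫ (ρ_ _).hom) =
      A k ◁ (K' k ◁ (e k).hom ≫ (ρ_ _).hom) ≫ t k ≫ B k ◁ (h k).hom
    have h4 : f.layer k = (A k ⊗ K' k) ◁ (e k).hom ≫ t k ▷ 𝟙_ C ≫
        (B k ⊗ K k) ◁ (e (k + 1)).inv := by
      rw [← Category.assoc, ← h₃ k]; simp
    rw [h4]
    have h5 : K k ◁ (e (k + 1)).inv ≫ (h k).hom ▷ f.mem (k + 1) ≫ K' (k + 1) ◁ (e (k + 1)).hom =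
        (h k).hom ▷ 𝟙_ C := by
      rw [whisker_exchange_assoc]; simp
    have h6 := congrArg (fun x => B k ◁ x) h5
    simp only [MonoidalCategory.whiskerLeft_comp] at h6
    simp [reassoc_of% h6]

variable [SymmetricCategory C]

theorem Equivalent.comp_ofHom {A B D : ℕ → C} {f : StSeq A B} {g : StSeq B D}
    {f' : ∀ k, A k ⟶ B k} {g' : ∀ k, B k ⟶ D k} (hf : f.Equivalent (ofHom f'))
    (hg : g.Equivalent (ofHom g')) : (f.comp g).Equivalent (ofHom fun k => f' k ≫ g' k) := by
  obtain ⟨e, h₁, h₂, h₃⟩ := equivalent_ofHom_iff.1 hf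
  obtain ⟨e', h₁', h₂', h₃'⟩ := equivalent_ofHom_iff.1 hg
  rw [equivalent_ofHom_iff]
  refine ⟨fun k => (e k ⊗ᵢ e' k) ≪≫ λ_ (𝟙_ C), fun k => ((h₁ k).tensorHom (h₁' k)).comp
    (Causal.leftUnitor _), unit_start h₂ h₂',
    fun k => comp_layer (h₃ k) (h₃' k)⟩

theorem Equivalent.tensor_ofHom {A B A' B' : ℕ → C} {f : StSeq A B} {g : StSeq A' B'}
    {f' : ∀ k, A k ⟶ B k} {g' : ∀ k, A' k ⟶ B' k} (hf : f.Equivalent (ofHom f'))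
    (hg : g.Equivalent (ofHom g')) : (f.tensor g).Equivalent (ofHom fun k => f' k ⊗ₘ g' k) := by
  obtain ⟨e, h₁, h₂, h₃⟩ := equivalent_ofHom_iff.1 hf
  obtain ⟨e', h₁', h₂', h₃'⟩ := equivalent_ofHom_iff.1 hg
  rw [equivalent_ofHom_iff]
  refine ⟨fun k => (e k ⊗ᵢ e' k) ≪≫ λ_ (𝟙_ C), fun k => ((h₁ k).tensorHom (h₁' k)).comp
    (Causal.leftUnitor _), unit_start h₂ h₂',
    fun k => tensor_layer (h₃ k) (h₃' k)⟩

end OfHom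

end StSeq

/-! ### Morphisms of the prop up to equality of their arities -/

section WireMaps

variable (G : Type u) [Category.{v} G] [MonoidalCategory G] [SymmetricCategory G] [MonoProp G]

/-- The morphisms `m → n` of a prop, for all `m` and `n`. -/
abbrev WireMap : Type v := Σ p : ℕ × ℕ, (wires G p.1 ⟶ wires G p.2)

variable {G}

/-- A morphism `m → n` of a prop, with `m` and `n` forgotten. -/
def wireMap {m n : ℕ} (f : wires G m ⟶ wires G n) : WireMap G := ⟨(m, n), f⟩

variable (G) in
/-- The identity of `n`. -/
def idMap (n : ℕ) : WireMap G := wireMap (𝟙 (wires G n))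

/-- The tensor product of morphisms of a prop. -/
def WireMap.tensor (x y : WireMap G) : WireMap G := wireMap (wiresTensor x.2 y.2)

theorem wireMap_congr {m n m' n' : ℕ} (hm : m = m') (hn : n = n') {f : wires G m ⟶ wires G n}
    {g : wires G m' ⟶ wires G n'} (h : f = (wiresEq G hm).hom ≫ g ≫ (wiresEq G hn).inv) :
    wireMap f = wireMap g := by
  subst hm hn
  simp [h, wiresEq]

theorem wireMap_injective {m n : ℕ} {f g : wires G m ⟶ wires G n} (h : wireMap f = wireMap g) :
    f = g :=
  eq_of_heq (Sigma.mk.inj h).2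

/-- Equality of dependent pairs identifies the arities first, after which `g` is a genuine identity.
-/
theorem wireMap_comp_of_eq_idMap {m n p l : ℕ} (f : wires G m ⟶ wires G n)
    (g : wires G n ⟶ wires G p) (h : wireMap g = idMap G l) : wireMap (f ≫ g) = wireMap f := by
  rw [wireMap, idMap, wireMap, Sigma.mk.injEq, Prod.mk.injEq] at h
  obtain ⟨⟨rfl, rfl⟩, h⟩ := h
  rw [eq_of_heq h, Category.comp_id]

theorem wireMap_comp_of_eq_idMap_left {m n p l : ℕ} (f : wires G m ⟶ wires G n)
    (g : wires G n ⟶ wires G p) (h : wireMap f = idMap G l) : wireMap (f ≫ g) = wireMap g := by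
  rw [wireMap, idMap, wireMap, Sigma.mk.injEq, Prod.mk.injEq] at h
  obtain ⟨⟨rfl, rfl⟩, h⟩ := h
  rw [eq_of_heq h, Category.id_comp]

theorem wireMap_wiresEq {m n : ℕ} (h : m = n) : wireMap (wiresEq G h).hom = idMap G m := by
  subst h; rfl

theorem wireMap_wiresEq_inv {m n : ℕ} (h : m = n) : wireMap (wiresEq G h).inv = idMap G m := by
  subst h; rfl

theorem idMap_tensor_idMap (m n : ℕ) : (idMap G m).tensor (idMap G n) = idMap G (m + n) := by
  simp [idMap, WireMap.tensor, wireMap, wiresTensor]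

theorem leftUnitor_inv_eq (X : G) :
    (λ_ X).inv = eqToHom (StrictMonoidal.unit_tensor X).symm := by
  rw [← cancel_epi (λ_ X).hom, Iso.hom_inv_id, StrictMonoidal.leftUnitor_hom, eqToHom_trans,
    eqToHom_refl]

theorem rightUnitor_inv_eq (X : G) :
    (ρ_ X).inv = eqToHom (StrictMonoidal.tensor_unit X).symm := by
  rw [← cancel_epi (ρ_ X).hom, Iso.hom_inv_id, StrictMonoidal.rightUnitor_hom, eqToHom_trans,
    eqToHom_refl]

/-- Unit and endpoints are variables constrained by equations, so that `U` can be substituted and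
all transports merge. Strictness turns the unitors into such transports. -/
theorem tensorHom_id_eq {X Y X' Y' U : G} (hU : U = 𝟙_ G) (f : X ⟶ Y) (h₁ : X' = X ⊗ U)
    (h₂ : Y ⊗ U = Y') (h₃ : X' = X) (h₄ : Y = Y') :
    eqToHom h₁ ≫ (f ⊗ₘ 𝟙 U) ≫ eqToHom h₂ = eqToHom h₃ ≫ f ≫ eqToHom h₄ := by
  subst hU
  rw [tensorHom_id, MonoidalCategory.whiskerRight_id, rightUnitor_inv_eq,
    StrictMonoidal.rightUnitor_hom]
  simp

theorem id_tensorHom_eq {X Y X' Y' U : G} (hU : U = 𝟙_ G) (f : X ⟶ Y) (h₁ : X' = U ⊗ X)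
    (h₂ : U ⊗ Y = Y') (h₃ : X' = X) (h₄ : Y = Y') :
    eqToHom h₁ ≫ (𝟙 U ⊗ₘ f) ≫ eqToHom h₂ = eqToHom h₃ ≫ f ≫ eqToHom h₄ := by
  subst hU
  rw [id_tensorHom, MonoidalCategory.id_whiskerLeft, leftUnitor_inv_eq,
    StrictMonoidal.leftUnitor_hom]
  simp

theorem braiding_eq_eqToHom {X Y : G} (h : X = 𝟙_ G ∨ Y = 𝟙_ G) (h' : X ⊗ Y = Y ⊗ X) :
    (β_ X Y).hom = eqToHom h' := by
  rcases h with rfl | rfl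
  · rw [braiding_tensorUnit_left, rightUnitor_inv_eq, StrictMonoidal.leftUnitor_hom, eqToHom_trans]
  · rw [braiding_tensorUnit_right, leftUnitor_inv_eq, StrictMonoidal.rightUnitor_hom,
      eqToHom_trans]

theorem tensor_idMap_zero (x : WireMap G) : x.tensor (idMap G 0) = x :=
  wireMap_congr (Nat.add_zero _) (Nat.add_zero _) (tensorHom_id_eq rfl x.2 (wires_add G _ 0)
    (wires_add G _ 0).symm (congrArg (wires G) (Nat.add_zero _))
    (congrArg (wires G) (Nat.add_zero _)).symm)

theorem idMap_zero_tensor (x : WireMap G) : (idMap G 0).tensor x = x :=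
  wireMap_congr (Nat.zero_add _) (Nat.zero_add _) (id_tensorHom_eq rfl x.2 (wires_add G 0 _)
    (wires_add G 0 _).symm (congrArg (wires G) (Nat.zero_add _))
    (congrArg (wires G) (Nat.zero_add _)).symm)

theorem wireMap_wiresSwap (m n : ℕ) (h : m = 0 ∨ n = 0) :
    wireMap (wiresSwap G m n) = idMap G (m + n) := by
  refine wireMap_congr rfl (Nat.add_comm n m) ?_
  rw [wiresSwap, braiding_eq_eqToHom (h.imp (fun h => h ▸ rfl) (fun h => h ▸ rfl))
    (by rw [← wires_add, ← wires_add, Nat.add_comm])]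
  simp [wiresSplit, wiresEq]

end WireMaps

/-! ### Diagrams with trivial memory -/

namespace Diagram

variable {G : Type u} [Category.{v} G] [MonoidalCategory G] [SymmetricCategory G] [MonoProp G]
  [DiscardCategory G]

/-- `D` realizes the family `H` if its stateful morphism sequence has a trivial memory and the
morphism `H k` as its `k`-th layer. -/
def Realizes {a b : Ty} (D : Diagram G a b) (H : ℕ → WireMap G) : Prop :=
  ∃ h : ∀ k, wires G (a.width k) ⟶ wires G (b.width k),
    D.toSt.Equivalent (StSeq.ofHom h) ∧ ∀ k, wireMap (h k) = H k

theorem Realizes.congr {a b : Ty} {D : Diagram G a b} {H H' : ℕ → WireMap G} (h : D.Realizes H)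
    (e : ∀ k, H k = H' k) : D.Realizes H' :=
  funext e ▸ h

theorem Realizes.id (a : Ty) : Realizes (.id a : Diagram G a a) fun k => idMap G (a.width k) :=
  ⟨_, .refl _, fun _ => rfl⟩

theorem Realizes.tensor {a b c d : Ty} {D : Diagram G a b} {E : Diagram G c d}
    {H H' : ℕ → WireMap G} (h : D.Realizes H) (h' : E.Realizes H') :
    (D.tensor E).Realizes fun k => (H k).tensor (H' k) := by
  obtain ⟨f, hf, e⟩ := h
  obtain ⟨f', hf', e'⟩ := h'
  have hE := (hf.tensor_ofHom hf').retype
    (fun k => wiresEq G (Ty.width_append a c k) ≪≫ wiresSplit G _ _)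
    (fun k => (wiresEq G (Ty.width_append b d k) ≪≫ wiresSplit G _ _).symm)
  rw [StSeq.retype_ofHom] at hE
  refine ⟨_, hE, fun k => ?_⟩
  dsimp only
  rw [← e, ← e']
  refine wireMap_congr (Ty.width_append _ _ k) (Ty.width_append _ _ k) ?_
  simp [wiresTensor, wireMap]

/-- Elements of `WireMap` compose only when arities match. Composition with identities avoids this,
and it is all that rewirings require. -/
theorem Realizes.comp_right {a b c : Ty} {D : Diagram G a b} {E : Diagram G b c}
    {H H' : ℕ → WireMap G} (h : D.Realizes H) (h' : E.Realizes H')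
    (hi : ∀ k, ∃ n, H' k = idMap G n) : (D.comp E).Realizes H := by
  obtain ⟨f, hf, e⟩ := h
  obtain ⟨f', hf', e'⟩ := h'
  refine ⟨_, hf.comp_ofHom hf', fun k => ?_⟩
  obtain ⟨n, hn⟩ := hi k
  rw [wireMap_comp_of_eq_idMap _ _ ((e' k).trans hn), e]

theorem Realizes.comp_left {a b c : Ty} {D : Diagram G a b} {E : Diagram G b c}
    {H H' : ℕ → WireMap G} (h : D.Realizes H) (h' : E.Realizes H')
    (hi : ∀ k, ∃ n, H k = idMap G n) : (D.comp E).Realizes H' := by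
  obtain ⟨f, hf, e⟩ := h
  obtain ⟨f', hf', e'⟩ := h'
  refine ⟨_, hf.comp_ofHom hf', fun k => ?_⟩
  obtain ⟨n, hn⟩ := hi k
  rw [wireMap_comp_of_eq_idMap_left _ _ ((e k).trans hn), e']

/-- A swap moves data only if both sides are active at the same tick. Otherwise it is a braiding
with the unit, which is an identity by strictness. -/
theorem Realizes.swap (a b : Ty) (h : ∀ k, a.width k = 0 ∨ b.width k = 0) :
    Realizes (.swap a b : Diagram G _ _) fun k => idMap G (a.width k + b.width k) := by
  refine ⟨_, .refl _, fun k => ?_⟩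
  rw [wireMap_comp_of_eq_idMap_left _ _ (wireMap_wiresEq _),
    wireMap_comp_of_eq_idMap _ _ (wireMap_wiresEq_inv _), wireMap_wiresSwap _ _ (h k)]

theorem Realizes.iota (n : ℕ) {p q : ℕ} (g : wires G p ⟶ wires G q) :
    (Diagram.iota n g).Realizes fun k => if k = n then wireMap g else idMap G 0 := by
  refine ⟨_, .refl _, fun k => ?_⟩
  dsimp only
  split_ifs with h
  · rw [wireMap_comp_of_eq_idMap_left _ _ (wireMap_wiresEq _),
      wireMap_comp_of_eq_idMap _ _ (wireMap_wiresEq _)]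
  · rw [wireMap_wiresEq, Ty.width_ones, if_neg h]

theorem Realizes.omega (n : ℕ) {p q : ℕ} (g : wires G p ⟶ wires G q) :
    (Diagram.omega n g).Realizes fun k => if n ≤ k then wireMap g else idMap G 0 := by
  refine ⟨_, .refl _, fun k => ?_⟩
  dsimp only
  split_ifs with h
  · rw [wireMap_comp_of_eq_idMap_left _ _ (wireMap_wiresEq _),
      wireMap_comp_of_eq_idMap _ _ (wireMap_wiresEq _)]
  · rw [wireMap_wiresEq, Ty.width_omegas, if_neg h]

theorem Realizes.deriv (n : ℕ) :
    (Diagram.deriv n : Diagram G _ _).Realizes fun k => idMap G ((Ty.omegas n 1).width k) :=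
  ⟨_, .refl _, fun _ => wireMap_wiresEq _⟩

theorem Realizes.init (n : ℕ) : (Diagram.init n : Diagram G _ _).Realizes
    fun k => idMap G ((Ty.ones n 1 ++ Ty.omegas (n + 1) 1).width k) :=
  ⟨_, .refl _, fun k =>
    (wireMap_wiresEq_inv _).trans (congrArg (idMap G) (Ty.width_derivative n k))⟩

end Diagram

/-! ### A normal form for types, separating the first ticks -/

namespace Ty

/-- The type that sends `w k` units of data at each tick `k` with `i ≤ k < i + n`, and `w (i + n)`
units at each later tick. -/
def timed (w : ℕ → ℕ) : ℕ → ℕ → Ty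
  | i, 0 => omegas i (w i)
  | i, n + 1 => ones i (w i) ++ timed w (i + 1) n

theorem width_timed (w : ℕ → ℕ) (i n k : ℕ) :
    (timed w i n).width k = if k < i then 0 else w (min k (i + n)) := by
  induction n generalizing i with
  | zero =>
    rw [timed, width_omegas]
    split_ifs with h h' h' <;> first | omega | skip
    rw [Nat.min_eq_right (by omega)]; rfl
  | succ n ih =>
    rw [timed, width_append, width_ones, ih]
    rcases Nat.lt_trichotomy k i with h | rfl | h
    · simp [h, h.ne, h.trans (Nat.lt_succ_self i)]
    · simp
    · rw [if_neg (by omega), if_neg (by omega), if_neg (by omega), Nat.zero_add,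
        Nat.add_right_comm, Nat.add_assoc]

theorem timed_of_eq_zero {w : ℕ → ℕ} {i : ℕ} (n : ℕ) (h : ∀ k, i ≤ k → w k = 0) :
    timed w i n = [] := by
  induction n generalizing i with
  | zero => simp [timed, omegas, h i le_rfl]
  | succ n ih =>
    rw [timed, ih fun k hk => h k (by omega), h i le_rfl]
    rfl

theorem timed_add_of_eq_zero {w : ℕ → ℕ} (i d n : ℕ) (h : ∀ k, i ≤ k → k < i + d → w k = 0) :
    timed w i (d + n) = timed w (i + d) n := by
  induction d generalizing i with
  | zero => simp
  | succ d ih =>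
    rw [Nat.add_right_comm, timed, h i le_rfl (by omega),
      ih (i + 1) fun k hk hk' => h k (by omega) (by omega), Nat.add_right_comm, ← Nat.add_assoc]
    rfl

end Ty

theorem Color.eq_delays (c : Color) :
    ∃ n, c = Color.delays n .one ∨ c = Color.delays n .omega := by
  induction c with
  | one => exact ⟨0, .inl rfl⟩
  | omega => exact ⟨0, .inr rfl⟩
  | delay c ih =>
    obtain ⟨n, rfl | rfl⟩ := ih
    · exact ⟨n + 1, .inl rfl⟩
    · exact ⟨n + 1, .inr rfl⟩

/-! ### Rewiring into normal form, and realization of eventually constant families -/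

section Rewiring

variable (G : Type u) [Category.{v} G] [MonoidalCategory G] [SymmetricCategory G] [MonoProp G]
  [DiscardCategory G]

/-- There are diagrams between `a` and `b` in both directions that act as identities at each
tick. -/
def Rewires (a b : Ty) : Prop :=
  (∃ D : Diagram G a b, D.Realizes fun k => idMap G (a.width k)) ∧
    ∃ D : Diagram G b a, D.Realizes fun k => idMap G (b.width k)

variable {G}

theorem Rewires.refl (a : Ty) : Rewires G a a := ⟨⟨_, .id a⟩, ⟨_, .id a⟩⟩

theorem Rewires.of_eq {a b : Ty} (h : a = b) : Rewires G a b := h ▸ .refl a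

theorem Rewires.trans {a b c : Ty} (h : Rewires G a b) (h' : Rewires G b c) : Rewires G a c := by
  obtain ⟨⟨D, hD⟩, ⟨E, hE⟩⟩ := h
  obtain ⟨⟨D', hD'⟩, ⟨E', hE'⟩⟩ := h'
  exact ⟨⟨_, hD.comp_right hD' fun _ => ⟨_, rfl⟩⟩, ⟨_, hE'.comp_right hE fun _ => ⟨_, rfl⟩⟩⟩

theorem Rewires.append {a b c d : Ty} (h : Rewires G a b) (h' : Rewires G c d) :
    Rewires G (a ++ c) (b ++ d) := by
  obtain ⟨⟨D, hD⟩, ⟨E, hE⟩⟩ := h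
  obtain ⟨⟨D', hD'⟩, ⟨E', hE'⟩⟩ := h'
  exact ⟨⟨_, (hD.tensor hD').congr fun k => by rw [idMap_tensor_idMap, Ty.width_append]⟩,
    ⟨_, (hE.tensor hE').congr fun k => by rw [idMap_tensor_idMap, Ty.width_append]⟩⟩

theorem Rewires.append_comm (a b : Ty) (h : ∀ k, a.width k = 0 ∨ b.width k = 0) :
    Rewires G (a ++ b) (b ++ a) := by
  exact ⟨⟨_, (Diagram.Realizes.swap a b h).congr fun k => by rw [Ty.width_append]⟩,
    ⟨_, (Diagram.Realizes.swap b a fun k => (h k).symm).congr fun k => by rw [Ty.width_append]⟩⟩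

theorem Rewires.derivative (n : ℕ) :
    Rewires G (Ty.omegas n 1) (Ty.ones n 1 ++ Ty.omegas (n + 1) 1) :=
  ⟨⟨_, .deriv n⟩, ⟨_, .init n⟩⟩

/-- The wires `ones i _` are active at tick `i` only and `timed _ (i + 1) n` only later, so they may
be exchanged without acting on data. -/
theorem Rewires.timed_append (w w' : ℕ → ℕ) (i n : ℕ) :
    Rewires G (Ty.timed w i n ++ Ty.timed w' i n) (Ty.timed (w + w') i n) := by
  induction n generalizing i with
  | zero => exact .of_eq (Ty.omegas_add i _ _).symm
  | succ n ih =>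
    have h : Rewires G
        (Ty.ones i (w i) ++ ((Ty.timed w (i + 1) n ++ Ty.ones i (w' i)) ++ Ty.timed w' (i + 1) n))
        (Ty.ones i (w i) ++ ((Ty.ones i (w' i) ++ Ty.timed w (i + 1) n) ++
          Ty.timed w' (i + 1) n)) :=
      (Rewires.refl _).append ((Rewires.append_comm _ _ fun k => by
        rw [Ty.width_timed, Ty.width_ones]; split_ifs <;> omega).append (.refl _))
    have h' := (Rewires.refl (G := G) (Ty.ones i (w i) ++ Ty.ones i (w' i))).append (ih (i + 1))
    rw [← Ty.ones_add] at h'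
    refine .trans (.of_eq ?_) (h.trans (.trans (.of_eq ?_) h'))
    · simp [Ty.timed]
    · simp [Ty.ones_add]

theorem Rewires.omegas_timed {w : ℕ → ℕ} (i n : ℕ) (h : ∀ k, i ≤ k → w k = 1) :
    Rewires G (Ty.omegas i 1) (Ty.timed w i n) := by
  induction n generalizing i with
  | zero => exact .of_eq (by rw [Ty.timed, h i le_rfl])
  | succ n ih =>
    rw [Ty.timed, h i le_rfl]
    exact (Rewires.derivative i).trans ((Rewires.refl _).append (ih (i + 1) fun k hk =>
      h k (by omega)))

theorem Color.rewires_timed (c : Color) :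
    ∃ N, ∀ n, N ≤ n → Rewires G [c] (Ty.timed c.width 0 n) := by
  obtain ⟨i, rfl | rfl⟩ := c.eq_delays
  -- Tick `i` must be listed separately: the final `ω` block then starts after it and is empty, so
  -- the two types coincide.
  · refine ⟨i + 1, fun n hn => ?_⟩
    obtain ⟨m, rfl⟩ := Nat.exists_eq_add_of_le hn
    refine .of_eq ?_
    rw [Nat.add_assoc, Ty.timed_add_of_eq_zero, Nat.zero_add, Nat.add_comm 1 m, Ty.timed,
      Ty.timed_of_eq_zero]
    · simp [Color.width_delays_one, Ty.ones]
    · intro k hk; rw [Color.width_delays_one, if_neg (by omega)]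
    · intro k hk hk'; rw [Color.width_delays_one, if_neg (by omega)]
  · refine ⟨i, fun n hn => ?_⟩
    obtain ⟨m, rfl⟩ := Nat.exists_eq_add_of_le hn
    rw [Ty.timed_add_of_eq_zero, Nat.zero_add]
    · exact Rewires.omegas_timed i m fun k hk => by rw [Color.width_delays_omega, if_pos hk]
    · intro k hk hk'; rw [Color.width_delays_omega, if_neg (by omega)]

/-- All large `n` are allowed so that different colors, and later the source and the target of a
diagram, can be expanded to a common depth. -/
theorem Ty.rewires_timed (a : Ty) : ∃ N, ∀ n, N ≤ n → Rewires G a (Ty.timed a.width 0 n) := by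
  induction a with
  | nil => exact ⟨0, fun n _ => .of_eq (Ty.timed_of_eq_zero n fun k _ => rfl).symm⟩
  | cons c a ih =>
    obtain ⟨N, h⟩ := ih
    obtain ⟨N', h'⟩ := Color.rewires_timed (G := G) c
    exact ⟨max N N', fun n hn => ((h' n (by omega)).append (h n (by omega))).trans
      (Rewires.timed_append _ _ 0 n)⟩

/-- At each tick at most one tensor factor has nonzero width, so the tensor acts as that factor
alone. The final `ω` generator repeats `h (i + n)` forever. -/
theorem exists_realizes_timed {w w' : ℕ → ℕ} (h : ∀ k, wires G (w k) ⟶ wires G (w' k))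
    (i n : ℕ) : ∃ D : Diagram G (Ty.timed w i n) (Ty.timed w' i n),
      D.Realizes fun k => if k < i then idMap G 0 else wireMap (h (min k (i + n))) := by
  induction n generalizing i with
  | zero =>
    refine ⟨.omega i (h i), (Diagram.Realizes.omega i (h i)).congr fun k => ?_⟩
    rcases Nat.lt_or_ge k i with hk | hk
    · rw [if_pos hk, if_neg (by omega)]
    · rw [if_pos hk, if_neg (by omega), Nat.min_eq_right (by omega)]; rfl
  | succ n ih =>
    obtain ⟨D, hD⟩ := ih (i + 1)
    refine ⟨.tensor (.iota i (h i)) D,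
      ((Diagram.Realizes.iota i (h i)).tensor hD).congr fun k => ?_⟩
    rcases Nat.lt_trichotomy k i with hk | rfl | hk
    · rw [if_neg (by omega), if_pos (by omega), if_pos hk, tensor_idMap_zero]
    · rw [if_pos rfl, if_pos (by omega), if_neg (by omega), tensor_idMap_zero,
        Nat.min_eq_left (by omega)]
    · rw [if_neg (by omega), if_neg (by omega), if_neg (by omega), idMap_zero_tensor,
        Nat.add_right_comm, Nat.add_assoc]

/-- Every eventually constant family of morphisms is realized by a diagram. -/
theorem exists_realizes {a b : Ty} (f : ∀ k, wires G (a.width k) ⟶ wires G (b.width k)) {N : ℕ}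
    (hf : ∀ k, N ≤ k → wireMap (f k) = wireMap (f N)) :
    ∃ D : Diagram G a b, D.Realizes fun k => wireMap (f k) := by
  obtain ⟨Na, ha⟩ := Ty.rewires_timed (G := G) a
  obtain ⟨Nb, hb⟩ := Ty.rewires_timed (G := G) b
  obtain ⟨D, hD⟩ := exists_realizes_timed f 0 (max N (max Na Nb))
  obtain ⟨A, hA⟩ := (ha (max N (max Na Nb)) (by omega)).1
  obtain ⟨B, hB⟩ := (hb (max N (max Na Nb)) (by omega)).2
  refine ⟨_, ((hA.comp_left hD fun _ => ⟨_, rfl⟩).comp_right hB fun _ => ⟨_, rfl⟩).congr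
    fun k => ?_⟩
  rw [if_neg (Nat.not_lt_zero k), Nat.zero_add]
  rcases Nat.le_total k (max N (max Na Nb)) with hk | hk
  · rw [Nat.min_eq_left hk]
  · rw [Nat.min_eq_right hk, hf _ (by omega), hf k (by omega)]

/-- Every stateful morphism sequence over a prop whose layers are eventually constant is that of a
diagram. -/
theorem exists_toSt_equivalent {a b : Ty} {m : ℕ → ℕ} (h₀ : 0 = m 0)
    (t : ∀ k, wires G (a.width k) ⊗ wires G (m k) ⟶ wires G (b.width k) ⊗ wires G (m (k + 1)))
    {N : ℕ} (hm : ∀ k, N ≤ k → m (k + 1) = m (N + 1))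
    (ht : ∀ k, N ≤ k → wireMap ((wiresSplit G _ _).hom ≫ t k ≫ (wiresSplit G _ _).inv) =
      wireMap ((wiresSplit G _ _).hom ≫ t N ≫ (wiresSplit G _ _).inv)) :
    ∃ D : Diagram G a b, D.toSt.Equivalent
      { mem := fun k => wires G (m k), start := wiresEq G h₀, layer := t } := by
  -- The color to be traced: `c` carries the memory after tick `k`, and `c.delay` the one before it.
  -- The delay is empty at tick `0`, in agreement with `m 0 = 0`.
  obtain ⟨c, hc⟩ : ∃ c : Ty, ∀ k, c.width k = m (k + 1) := by
    refine ⟨Ty.timed (fun k => m (k + 1)) 0 N, fun k => ?_⟩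
    rw [Ty.width_timed, if_neg (Nat.not_lt_zero k), Nat.zero_add]
    rcases Nat.le_total k N with hk | hk
    · rw [Nat.min_eq_left hk]
    · rw [Nat.min_eq_right hk, hm k hk]
  have hc' : ∀ k, c.delay.width k = m k
    | 0 => (Ty.width_delay_zero c).trans h₀
    | k + 1 => (Ty.width_delay_succ c k).trans (hc k)
  have ha : ∀ k, (a ++ c.delay).width k = a.width k + m k := fun k => by
    rw [Ty.width_append, hc']
  have hb : ∀ k, (b ++ c).width k = b.width k + m (k + 1) := fun k => by
    rw [Ty.width_append, hc]
  obtain ⟨E, f, hE, e⟩ := exists_realizes (a := a ++ c.delay) (b := b ++ c) (N := N)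
    (fun k => (wiresEq G (ha k)).hom ≫ ((wiresSplit G _ _).hom ≫ t k ≫ (wiresSplit G _ _).inv) ≫
      (wiresEq G (hb k)).inv) (fun k hk => by
      rw [wireMap_congr (ha k) (hb k) rfl, wireMap_congr (ha N) (hb N) rfl, ht k hk])
  -- Realization fixes the layers only as elements of `WireMap`. The arities being known here, the
  -- morphisms themselves agree.
  obtain rfl := funext fun k => wireMap_injective (e k)
  refine ⟨.trace c E, ?_⟩
  have h₁ := hE.retype (fun k => (wiresEq G (Ty.width_append _ _ k) ≪≫ wiresSplit G _ _).symm)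
    (fun k => wiresEq G (Ty.width_append _ _ k) ≪≫ wiresSplit G _ _)
  rw [StSeq.retype_ofHom] at h₁
  refine (h₁.trace_ofHom (K' := fun k => wires G (c.delay.width k))
    (wiresEq G (m := 0) (Ty.width_delay_zero c).symm)
    (fun k => wiresEq G (Ty.width_delay_succ c k).symm)).trans
    ⟨fun k => wiresEq G (hc' k), fun k => Causal.eqToHom (congrArg (wires G) (hc' k)), ?_,
      fun k => ?_⟩
  · exact eqToHom_trans (congrArg (wires G) (Ty.width_delay_zero c).symm)
      (congrArg (wires G) (hc' 0))
  · simp [wiresEq, wiresSplit]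

end Rewiring

/-! ### Change of memory along an isomorphism -/

section Layers

variable {C : Type u} [Category.{v} C] [MonoidalCategory C]

/-- Conjugating the layer by `e` commutes with iteration. Thus the memory of the regular part can be
replaced by an object in the image of the functor. -/
theorem compAlong_comp_iso {A₁ B₁ K K' A₂ B₂ : C} (f : A₁ ⟶ B₁ ⊗ K) (e : K' ≅ K)
    (l : K ⊗ A₂ ⟶ B₂ ⊗ K) :
    compAlong (f ≫ B₁ ◁ e.inv) (e.hom ▷ A₂ ≫ l ≫ B₂ ◁ e.inv) ≫ (α_ B₁ B₂ K').inv =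
      (compAlong f l ≫ (α_ B₁ B₂ K).inv) ≫ (B₁ ⊗ B₂) ◁ e.inv := by
  have h : B₁ ◁ e.inv ▷ A₂ ≫ B₁ ◁ e.hom ▷ A₂ = 𝟙 _ := by
    rw [← MonoidalCategory.whiskerLeft_comp, ← comp_whiskerRight]; simp
  simp [compAlong, reassoc_of% h]

theorem IsPseudoPurification.of_comp_causal [DiscardCategory C] {A B X X' : C} {f : A ⟶ B}
    {p : A ⟶ B ⊗ X} (h : IsPseudoPurification f p) {q : A ⟶ B ⊗ X'} {e : X' ⟶ X} (he : Causal e)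
    (hq : p = q ≫ B ◁ e) : IsPseudoPurification f q := by
  intro Y g hg
  obtain ⟨c, hc, rfl⟩ := h Y g hg
  exact ⟨e ≫ c, he.comp hc, by simp [hq]⟩

end Layers

/-! ### Lifting layers along the functor, and the universality theorem -/

section Universality

open Functor.LaxMonoidal Functor.OplaxMonoidal

variable {G : Type u₁} [Category.{v₁} G] [MonoidalCategory G]
  {C : Type u₂} [Category.{v₂} C] [MonoidalCategory C] (F : G ⥤ C)

section Full

variable [F.Monoidal] [F.Full]

theorem exists_first_layer {X Z W : G} (p : F.obj X ⟶ F.obj Z ⊗ F.obj W) :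
    ∃ t : X ⊗ 𝟙_ G ⟶ Z ⊗ W,
      (ρ_ (F.obj X)).inv ≫ F.obj X ◁ ε F ≫ μ F X (𝟙_ G) ≫ F.map t ≫ δ F Z W = p := by
  refine ⟨F.preimage (δ F X (𝟙_ G) ≫ F.obj X ◁ η F ≫ (ρ_ _).hom ≫ p ≫ μ F Z W), ?_⟩
  simp [← MonoidalCategory.whiskerLeft_comp_assoc]

variable [SymmetricCategory C]

/-- A layer of a stateful morphism sequence over `G`, given its image in `C` with the memory as the
first input. -/
noncomputable def liftLayer {X Y Z W : G} (l : F.obj X ⊗ F.obj Y ⟶ F.obj Z ⊗ F.obj W) :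
    Y ⊗ X ⟶ Z ⊗ W :=
  F.preimage (δ F Y X ≫ (β_ (F.obj Y) (F.obj X)).hom ≫ l ≫ μ F Z W)

theorem braiding_comp_map_liftLayer {X Y Z W : G} (l : F.obj X ⊗ F.obj Y ⟶ F.obj Z ⊗ F.obj W) :
    (β_ (F.obj X) (F.obj Y)).hom ≫ μ F Y X ≫ F.map (liftLayer F l) ≫ δ F Z W = l := by
  simp [liftLayer]

end Full

variable [SymmetricCategory C] [SymmetricCategory G] [MonoProp G]

/-- The sizes of the memories before each tick, given those after each tick. -/
def memories (m : ℕ → ℕ) : ℕ → ℕ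
  | 0 => 0
  | k + 1 => m k

/-- The layers of a stateful morphism sequence, given the first one and the others. -/
def layers {A B : ℕ → G} {m : ℕ → ℕ} (t₀ : A 0 ⊗ 𝟙_ G ⟶ B 0 ⊗ wires G (m 0))
    (t : ∀ k, A (k + 1) ⊗ wires G (m k) ⟶ B (k + 1) ⊗ wires G (m (k + 1))) :
    ∀ k, A k ⊗ wires G (memories m k) ⟶ B k ⊗ wires G (memories m (k + 1))
  | 0 => t₀
  | k + 1 => t k

/-- The run satisfies the same recursion as `r`. Tick `0` is separate because its memory is the
unit, inserted through `ε`. -/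
theorem run_map_eq [F.Monoidal] {A B : ℕ → G} {m : ℕ → ℕ} (h₀ : 𝟙_ G ≅ wires G 0)
    (h₀' : h₀.hom = 𝟙 (𝟙_ G))
    (t₀ : A 0 ⊗ 𝟙_ G ⟶ B 0 ⊗ wires G (m 0))
    (t : ∀ k, A (k + 1) ⊗ wires G (m k) ⟶ B (k + 1) ⊗ wires G (m (k + 1)))
    (r : ∀ k, upTo (fun k => F.obj (A k)) k ⟶
      upTo (fun k => F.obj (B k)) k ⊗ F.obj (wires G (m k)))
    (hr₀ : (ρ_ (F.obj (A 0))).inv ≫ F.obj (A 0) ◁ ε F ≫ μ F _ _ ≫ F.map t₀ ≫ δ F _ _ = r 0)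
    (hr : ∀ k, compAlong (r k) ((β_ (F.obj (wires G (m k))) (F.obj (A (k + 1)))).hom ≫
      μ F _ _ ≫ F.map (t k) ≫ δ F _ _) ≫ (α_ _ _ _).inv = r (k + 1)) (k : ℕ) :
    (StSeq.map F (A := A) (B := B)
      { mem := fun k => wires G (memories m k), start := h₀, layer := layers t₀ t }).run k =
      r k := by
  induction k with
  | zero =>
    rw [← hr₀]
    change _ ≫ F.obj (A 0) ◁ (ε F ≫ F.map h₀.hom) ≫ _ = _
    rw [h₀']
    erw [F.map_id, Category.comp_id]
    rfl
  | succ k ih =>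
    rw [← hr, ← ih]
    rfl

variable {F} [DiscardCategory C]

theorem exists_pure_wires (hC : PseudoPurifiable C)
    (hobj : ∀ X : C, ∃ (n : ℕ) (e : F.obj (wires G n) ≅ X), Causal e.hom) {A B : C} (f : A ⟶ B) :
    ∃ (m : ℕ) (p : A ⟶ B ⊗ F.obj (wires G m)), IsPseudoPurification f p := by
  obtain ⟨X, p, hp⟩ := hC.exists_pure f
  obtain ⟨m, e, he⟩ := hobj X
  exact ⟨m, p ≫ B ◁ e.inv, hp.of_comp_causal he (by simp)⟩

variable (F) in
/-- A morphism `A k → B k` with a memory in the image of the prop as an additional output. -/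
abbrev MemState (A B : ℕ → C) (k : ℕ) : Type v₂ :=
  Σ m : ℕ, (upTo A k ⟶ upTo B k ⊗ F.obj (wires G m))

/-- Purifications are taken strictly below `N`, and the prescribed states `it` from `N` on. Both
discard to `g`, which is what allows the two parts to be joined. -/
theorem exists_states (hC : PseudoPurifiable C)
    (hobj : ∀ X : C, ∃ (n : ℕ) (e : F.obj (wires G n) ≅ X), Causal e.hom) {A B : ℕ → C}
    (g : ∀ k, upTo A k ⟶ upTo B k) {n N : ℕ} (hn : n ≤ N) (it : ∀ j, MemState F A B (n + j))
    (hit : ∀ j, discardOut (it j).2 = g (n + j)) :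
    ∃ s : ∀ k, MemState F A B k, (∀ k, discardOut (s k).2 = g k) ∧
      (∀ k, k < N → IsPseudoPurification (g k) (s k).2) ∧ ∀ j, N ≤ n + j → s (n + j) = it j := by
  -- The index `k` is fixed before `j`, so agreement with `it j` is stated through a transport. It
  -- disappears when `k` is `n + j`.
  have h : ∀ k, ∃ s : MemState F A B k, discardOut s.2 = g k ∧
      (k < N → IsPseudoPurification (g k) s.2) ∧ ∀ j (h : n + j = k), N ≤ k → s = h ▸ it j := by
    intro k
    rcases Nat.lt_or_ge k N with hk | hk
    · obtain ⟨m, p, hp⟩ := exists_pure_wires hC hobj (g k)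
      exact ⟨⟨m, p⟩, hp.discardOut_eq, fun _ => hp, fun j _ h => absurd hk (by omega)⟩
    · obtain ⟨j, rfl⟩ := Nat.exists_eq_add_of_le (hn.trans hk)
      refine ⟨it j, hit j, fun h => absurd hk (by omega), fun j' h _ => ?_⟩
      obtain rfl := Nat.add_left_cancel h
      rfl
  choose s h₁ h₂ h₃ using h
  exact ⟨s, h₁, h₂, fun j hj => h₃ _ j rfl hj⟩

end Universality

end StreamLang

theorem mainTheorem2
    {G : Type u₁} [Category.{v₁} G] [MonoidalCategory G] [SymmetricCategory G] [MonoProp G]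
    [DiscardCategory G]
    {C : Type u₂} [Category.{v₂} C] [MonoidalCategory C] [SymmetricCategory C] [DiscardCategory C]
    (F : G ⥤ C) [F.Monoidal] (hF : DiscardPreserving F)
    (hobj : ∀ X : C, ∃ (n : ℕ) (e : F.obj (wires G n) ≅ X), Causal e.hom)
    (hC : PseudoPurifiable C) [F.Full]
    (a b : Ty) (g : FAHom (semTy F a) (semTy F b)) :
    ∃ D : StreamHom G a b, D.Denotes F g.app := by
  obtain ⟨g, hmono, n, M, A', B', hA, hB, gi, gr, hg⟩ := g
  obtain ⟨na, wa, ha⟩ := a.width_eventually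
  obtain ⟨nb, wb, hb⟩ := b.width_eventually
  obtain ⟨m, e, he⟩ := hobj M
  -- Past `N` the regular form is available and the widths of both types are constant.
  obtain ⟨N, hN⟩ : ∃ N, N = max n (max na nb) := ⟨_, rfl⟩
  let A : ℕ → C := fun k => F.obj (wires G (a.width k))
  let B : ℕ → C := fun k => F.obj (wires G (b.width k))
  -- the layer that recurs from tick `N` on, for inputs and outputs of any size
  let τ (w w' : ℕ) (h : F.obj (wires G w) = A') (h' : F.obj (wires G w') = B') :
      F.obj (wires G m) ⊗ F.obj (wires G w) ⟶ F.obj (wires G w') ⊗ F.obj (wires G m) :=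
    e.hom ▷ _ ≫ (M ◁ eqToHom h ≫ gr ≫ eqToHom h'.symm ▷ M) ≫ _ ◁ e.inv
  -- The widths at different late ticks are equal but not definitionally so. With the arities
  -- forgotten, the lifted layers at these ticks become the same element.
  have hτ : ∀ {w w' w₁ w₁' : ℕ} (h h' h₁ h₁'), w = w₁ → w' = w₁' →
      wireMap ((wiresSplit G w m).hom ≫ liftLayer F (τ w w' h h') ≫ (wiresSplit G w' m).inv) =
      wireMap ((wiresSplit G w₁ m).hom ≫ liftLayer F (τ w₁ w₁' h₁ h₁') ≫
        (wiresSplit G w₁' m).inv) := by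
    rintro w w' _ _ _ _ _ _ rfl rfl; rfl
  let it (j : ℕ) : MemState F A B (n + j) :=
    ⟨m, iterateFrom n gi (fun i => M ◁ eqToHom (hA (n + i + 1) (by omega)) ≫ gr ≫
      eqToHom (hB (n + i + 1) (by omega)).symm ▷ M) j ≫ _ ◁ e.inv⟩
  obtain ⟨s, hs, hpure, hit⟩ := exists_states hC hobj g (N := N) (by omega) it fun j => by
    rw [hg]; exact discardOut_comp_whiskerLeft _ he.inv
  have hwa : F.obj (wires G wa) = A' := by
    rw [← ha (N + 1) (by omega)]; exact hA (N + 1) (by omega)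
  have hwb : F.obj (wires G wb) = B' := by
    rw [← hb (N + 1) (by omega)]; exact hB (N + 1) (by omega)
  have hstep : ∀ k, ∃ t : wires G (a.width (k + 1)) ⊗ wires G (s k).1 ⟶
      wires G (b.width (k + 1)) ⊗ wires G (s (k + 1)).1,
      compAlong (s k).2 ((β_ (F.obj (wires G (s k).1)) (F.obj (wires G (a.width (k + 1))))).hom ≫
        Functor.LaxMonoidal.μ F _ _ ≫ F.map t ≫ Functor.OplaxMonoidal.δ F _ _) ≫
        (α_ _ _ _).inv = (s (k + 1)).2 ∧
      (N ≤ k → wireMap ((wiresSplit G _ _).hom ≫ t ≫ (wiresSplit G _ _).inv) =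
        wireMap ((wiresSplit G _ _).hom ≫ liftLayer F (τ wa wb hwa hwb) ≫
          (wiresSplit G _ _).inv)) := by
    intro k
    rcases Nat.lt_or_ge k N with hk | hk
    -- When `k + 1 = N` the next state already belongs to the regular part. It suffices that it
    -- discards to `g (k + 1)`.
    · obtain ⟨l, hl⟩ := (hpure k hk).exists_layer hC (hmono k) (hs (k + 1))
      have hβ := braiding_comp_map_liftLayer F (X := wires G (s k).1)
        (Y := wires G (a.width (k + 1))) (Z := wires G (b.width (k + 1)))
        (W := wires G (s (k + 1)).1) l
      exact ⟨_, (congrArg (fun x => compAlong (s k).2 x ≫ (α_ _ _ _).inv) hβ).trans hl.symm,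
        fun h => absurd hk (by omega)⟩
    · obtain ⟨j, rfl⟩ := Nat.exists_eq_add_of_le (show n ≤ k by omega)
      have h₁ := hit j hk
      have h₂ : s (n + j + 1) = it (j + 1) := hit (j + 1) (by omega)
      rw [h₁, h₂]
      refine ⟨liftLayer F (τ _ _ (hA (n + j + 1) (by omega)) (hB (n + j + 1) (by omega))), ?_,
        fun _ => hτ _ (hB (n + j + 1) (by omega)) _ hwb (ha _ (by omega)) (hb _ (by omega))⟩
      rw [braiding_comp_map_liftLayer]
      exact compAlong_comp_iso _ e _
  choose t ht ht' using hstep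
  obtain ⟨t₀, ht₀⟩ := exists_first_layer F (s 0).2
  have hm : ∀ k, N ≤ k → (s k).1 = m := fun k hk => by
    obtain ⟨j, rfl⟩ := Nat.exists_eq_add_of_le (show n ≤ k by omega)
    rw [hit j hk]
  -- The layer at tick `k + 1` joins state `k` to state `k + 1`, so a tail that is regular from
  -- state `N` gives constant layers from `N + 1`.
  obtain ⟨D, hD⟩ := exists_toSt_equivalent (a := a) (b := b) (m := memories fun k => (s k).1)
    (N := N + 1) rfl
    (layers (A := fun k => wires G (a.width k)) (B := fun k => wires G (b.width k)) t₀ t)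
    (fun k hk => (hm k (by omega)).trans (hm (N + 1) (by omega)).symm) (fun k hk => by
      obtain ⟨k, rfl⟩ := Nat.exists_eq_add_of_le' (show 1 ≤ k by omega)
      exact (ht' k (by omega)).trans (ht' N le_rfl).symm)
  refine ⟨Quot.mk _ D, D, rfl, funext fun k => ?_⟩
  -- The diagram has the constructed layers only up to causal isomorphism of memories, which the
  -- approximations do not detect.
  rw [Diagram.sem, (hD.map hF).approx_eq, StSeq.approx]
  exact (congrArg discardOut (run_map_eq F (wiresEq G (m := 0) (n := 0) rfl) rfl t₀ t
    (fun k => (s k).2) ht₀ ht k)).trans (hs k)
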